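/- Let $A$ be a finite alphabet. Words over $A$ (including the empty word) are viewed as logical structures whose domain is the set of positions, with a unary predicate $P_a$ for each letter $a\in A$ (selecting the positions labeled by $a$) and the linear order $<$ on positions; $\mathrm{FO}(<)$ is first-order logic over this signature. A formula of $\mathrm{FO}(<)$ is $\Sigma_i(<)$ (resp. $\Pi_i(<)$) if the prenex rewriting rules bring it to a prenex normal form with at most $i$ blocks of quantifiers, where a form with exactly $i$ blocks starts with an existential (resp. universal) block. A language $L\subseteq A^*$ is definable in $\Sigma_i(<)$ (resp. $\Pi_i(<)$) if it is the set of words satisfying some $\Sigma_i(<)$ (resp. $\Pi_i(<)$) sentence, and definable in $\Delta_i(<)$ if it is definable both in $\Sigma_i(<)$ and in $\Pi_i(<)$. Then each of the following three problems is decidable: given a finite alphabet and a regular language $L$ over it (presented by a nondeterministic finite automaton), decide whether $L$ is definable in $\Delta_3(<)$; decide whether $L$ is definable in $\Sigma_3(<)$; decide whether $L$ is definable in $\Pi_3(<)$. -/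

import Mathlib

namespace WordLogic

/-- Relation symbols of `FO(<)` over the alphabet `A`: a unary predicate for each letter,
and the binary predicate `<`. (Equality is part of the logic.) -/
inductive WordRel (A : Type) : ℕ → Type
  | letter (a : A) : WordRel A 1
  | lt : WordRel A 2

/-- The first-order signature of words over `A`. It has no function symbols. -/
def wordLang (A : Type) : FirstOrder.Language.{0, 0} :=
  ⟨fun _ => Empty, WordRel A⟩

/-- The word `w` as a logical structure: the domain is the set of positions of `w`
(empty if `w` is the empty word), `letter a` selects the positions labeled by `a`, and `lt` is the
order of positions. -/
@[reducible]
def wordStructure {A : Type} (w : List A) : (wordLang A).Structure (Fin w.length) where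
  funMap := fun f => Empty.elim f
  RelMap := fun R =>
    match R with
    | WordRel.letter a => fun x => w.get (x 0) = a
    | WordRel.lt => fun x => x 0 < x 1

/-- The word `w` satisfies the sentence `φ`. -/
def Satisfies {A : Type} (w : List A) (φ : (wordLang A).Sentence) : Prop :=
  @FirstOrder.Language.Sentence.Realize (wordLang A) (Fin w.length) (wordStructure w) φ

/-- The two kinds of quantifiers. -/
inductive Quantifier : Type
  | ex
  | all

/-- The dual quantifier. -/
def Quantifier.dual : Quantifier → Quantifier
  | .ex => .all
  | .all => .ex

/-- `HasLevel Q i φ`: by the usual prenex rewriting rules, the first-order formula `φ` (not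
necessarily prenex) can be put in prenex normal form with at most `i` blocks of quantifiers, where
the first block of a form with exactly `i` blocks consists of quantifiers of kind `Q`.

The primitive connectives of formulas are `⊥`, `→` and `∀`; negation is `φ → ⊥`, and `∧`, `∨`, `∃`
are expressed through these. The rules say: a quantifier-free formula has every level; in an
implication, the premise (which is under a negation) has the dual level; a block of universal
quantifiers may be extended by a universal quantifier; and a formula with at most `i` blocks, with
whatever first block, is one with at most `i + 1` blocks. -/
inductive HasLevel {L : FirstOrder.Language.{0, 0}} {α : Type} :
    Quantifier → ℕ → {n : ℕ} → L.BoundedFormula α n → Prop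
  | qf {Q : Quantifier} {i n : ℕ} {φ : L.BoundedFormula α n} (h : φ.IsQF) : HasLevel Q i φ
  | imp {Q : Quantifier} {i n : ℕ} {φ ψ : L.BoundedFormula α n}
      (hφ : HasLevel Q.dual i φ) (hψ : HasLevel Q i ψ) : HasLevel Q i (φ.imp ψ)
  | all {i n : ℕ} {φ : L.BoundedFormula α (n + 1)}
      (h : HasLevel Quantifier.all (i + 1) φ) : HasLevel Quantifier.all (i + 1) φ.all
  | next {Q : Quantifier} {i n : ℕ} {φ : L.BoundedFormula α n}
      (h : HasLevel Q.dual i φ) : HasLevel Q (i + 1) φ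

/-- `φ` is a `Σᵢ(<)` formula. -/
def IsSigma {A : Type} (i : ℕ) (φ : (wordLang A).Sentence) : Prop :=
  HasLevel Quantifier.ex i φ

/-- `φ` is a `Πᵢ(<)` formula. -/
def IsPi {A : Type} (i : ℕ) (φ : (wordLang A).Sentence) : Prop :=
  HasLevel Quantifier.all i φ

/-- The language `K` is definable by a `Σᵢ(<)` sentence. -/
def SigmaDefinable {A : Type} (i : ℕ) (K : Language A) : Prop :=
  ∃ φ : (wordLang A).Sentence, IsSigma i φ ∧ ∀ w : List A, w ∈ K ↔ Satisfies w φ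

/-- The language `K` is definable by a `Πᵢ(<)` sentence. -/
def PiDefinable {A : Type} (i : ℕ) (K : Language A) : Prop :=
  ∃ φ : (wordLang A).Sentence, IsPi i φ ∧ ∀ w : List A, w ∈ K ↔ Satisfies w φ

/-- The language `K` is `Δᵢ(<)`-definable: definable both by a `Σᵢ(<)` sentence and by a
`Πᵢ(<)` sentence. -/
def DeltaDefinable {A : Type} (i : ℕ) (K : Language A) : Prop :=
  SigmaDefinable i K ∧ PiDefinable i K

/-- A finite description of a nondeterministic finite automaton, the input of the decision
problems: `(k, n, T, I, F)` consists of the number `k` of letters, the number `n` of states, the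
list `T` of transitions `(q, a, q')`, and the lists `I` and `F` of initial and final states.
Entries of the lists that are out of range have no effect. -/
abbrev AutomatonCode : Type :=
  ℕ × ℕ × List (ℕ × ℕ × ℕ) × List ℕ × List ℕ

/-- The number of letters: the alphabet is `Fin c.letters`. -/
abbrev AutomatonCode.letters (c : AutomatonCode) : ℕ := c.1

/-- The number of states: the set of states is `Fin c.states`. -/
abbrev AutomatonCode.states (c : AutomatonCode) : ℕ := c.2.1

/-- The nondeterministic finite automaton described by a code. -/
def AutomatonCode.toNFA (c : AutomatonCode) : NFA (Fin c.letters) (Fin c.states) where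
  step q a := {q' | ((q : ℕ), (a : ℕ), (q' : ℕ)) ∈ c.2.2.1}
  start := {q | (q : ℕ) ∈ c.2.2.2.1}
  accept := {q | (q : ℕ) ∈ c.2.2.2.2}

/-- The regular language given by a code. -/
def AutomatonCode.language (c : AutomatonCode) : Language (Fin c.letters) :=
  c.toNFA.accepts

end WordLogic

/-! By Ehrenfeucht–Fraïssé games, a language is `Σ₃(<)`-definable iff it is closed upwards for one
of the preorders `GameLE 3 r`: formulas are preserved in the game, and since each preorder has
finitely many classes, its closed sets are finite disjunctions of `gameFormula`s
(`sigmaDefinable_iff`).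

For a language recognized by a morphism onto a finite monoid, this becomes algebraic
(`sigma_three_iff`). Call `(t, e)` a `Σ₂`-pair if at every rank some word of value `t` is below some
word of value `e` at level 2. The condition is that in an accepted product an idempotent `e` may be
replaced by `e * t * e` for every `Σ₂`-pair `(t, e)`. It is necessary because a word below `w` at
level 2 can be inserted into large powers of `w` at level 3 (`gameLE_insert`).

Sufficiency needs one rank that works for all words. It comes from `IsCover.exists_bound`, a variant
of Simon's factorization theorem: every word is built with bounded cost from letters by products and
by loops `w * z * w'`, where the value of `z` is an idempotent absorbed by the values of `w` and
`w'`. The complexity of `z` is not charged, because only coarse information on the middle factor is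
used: at level 3, that it gives a `Σ₂`-pair.

The `Σ₂`-pairs are computed by saturating a set of elements (value, set of values). The same bound,
with the set of letters as the coarse information one level down, shows that a saturated set
contains all pairs (`IsSaturated.exists_of_isPair`); insertion into powers shows that only pairs
arise (`IsSound.loop`). Saturation stabilizes by finiteness and stability can be tested, so an
unbounded search ends at a stage where the condition is a finite check. `Π₃(<)` follows by
complementation and `Δ₃(<)` by conjunction. -/

namespace WordLogic

/-! ### Bounded factorizations in finite monoids -/

section Factorization

set_option linter.unusedSectionVars false

variable {N : Type*} [Monoid N]

/-- `F` is an idempotent that is a right unit for `a` and a left unit for `b`, and is a left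
multiple of `a`. -/
structure IsLink (a b F : N) : Prop where
  idem : F * F = F
  right : a * F = a
  left : F * b = b
  ofRight : ∃ c, F = c * a

/-- The number of elements of the two-sided ideal of `v`. -/
noncomputable def idealCard (v : N) : ℕ := {x | ∃ y z, x = y * v * z}.ncard

/-! ### Green's relations in a finite monoid, measured by sizes of ideals. -/

theorem idealCard_pos [Finite N] (v : N) : 0 < idealCard v :=
  (Set.ncard_pos (Set.toFinite _)).2 ⟨v, 1, 1, by simp⟩

theorem idealCard_le [Finite N] {u v x y : N} (h : u = x * v * y) : idealCard u ≤ idealCard v := by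
  refine Set.ncard_le_ncard ?_ (Set.toFinite _)
  rintro _ ⟨y', z', rfl⟩
  exact ⟨y' * x, y * z', by simp [h, mul_assoc]⟩

/-- The ideal of `u` lies in that of `v`, so equal finite size forces equality; comparing sizes thus
stands in for the `J`-order. -/
theorem mem_ideal_of_idealCard_le [Finite N] {u v x y : N} (h : u = x * v * y)
    (hle : idealCard v ≤ idealCard u) : ∃ y z, v = y * u * z := by
  have : {t | ∃ y z, t = y * u * z} = {t | ∃ y z, t = y * v * z} := by
    refine Set.eq_of_subset_of_ncard_le ?_ hle (Set.toFinite _)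
    rintro _ ⟨y', z', rfl⟩
    exact ⟨y' * x, y * z', by simp [h, mul_assoc]⟩
  have hv : v ∈ {t | ∃ y z, t = y * v * z} := ⟨1, 1, by simp⟩
  rwa [← this] at hv

/-- Powers are eventually periodic by pigeonhole; an exponent past the preperiod that is a multiple
of the period works. -/
theorem exists_pow_idem [Finite N] (a : N) : ∃ n, 0 < n ∧ a ^ n * a ^ n = a ^ n := by
  obtain ⟨i, j, hij, h⟩ := Finite.exists_ne_map_eq_of_infinite (fun i : ℕ => a ^ i)
  wlog hlt : i < j generalizing i j
  · exact this j i hij.symm h.symm (lt_of_le_of_ne (not_lt.1 hlt) hij.symm)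
  obtain ⟨p, rfl⟩ := Nat.exists_eq_add_of_lt hlt
  have key : ∀ m, i ≤ m → ∀ t, a ^ (m + t * (p + 1)) = a ^ m := by
    intro m hm t
    induction t with
    | zero => simp
    | succ t ih =>
      have h' : a ^ i = a ^ (i + p + 1) := h
      calc a ^ (m + (t + 1) * (p + 1)) = a ^ (i + p + 1) * a ^ (m - i + t * (p + 1)) := by
            rw [← pow_add]; congr 1
            have : (t + 1) * (p + 1) = t * (p + 1) + (p + 1) := by ring
            omega
        _ = a ^ (m + t * (p + 1)) := by rw [← h', ← pow_add]; congr 1; omega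
        _ = a ^ m := ih
  refine ⟨(i + 1) * (p + 1), by positivity, ?_⟩
  rw [← pow_add]
  exact key _ (by nlinarith) _

/-- Stability of finite monoids: if `a` is `J`-equivalent to `a * b`, it is `R`-equivalent to it.
Iterating `a = y * a * (b * z)` until the power of `b * z` is idempotent makes this power a right
unit of `a`. -/
theorem exists_mul_right_of_mem_ideal [Finite N] {a b y z : N} (h : a = y * (a * b) * z) :
    ∃ x, a = a * b * x := by
  have hn : ∀ n, a = y ^ n * a * (b * z) ^ n := by
    intro n
    induction n with
    | zero => simp
    | succ n ih =>
      calc a = y * a * (b * z) := by rw [mul_assoc y a, ← mul_assoc a]; simpa [mul_assoc] using h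
        _ = y * (y ^ n * a * (b * z) ^ n) * (b * z) := by rw [← ih]
        _ = _ := by rw [pow_succ' y, pow_succ (b * z)]; simp only [mul_assoc]
  obtain ⟨n, hpos, hidem⟩ := exists_pow_idem (b * z)
  refine ⟨z * (b * z) ^ (n - 1), ?_⟩
  have h1 : a * (b * z) ^ n = a := by
    calc a * (b * z) ^ n = y ^ n * a * ((b * z) ^ n * (b * z) ^ n) := by
          rw [← mul_assoc, ← hn n]
      _ = a := by rw [hidem, ← hn n]
  calc a = a * (b * z) ^ n := h1.symm
    _ = a * ((b * z) * (b * z) ^ (n - 1)) := by rw [← pow_succ', Nat.sub_add_cancel hpos]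
    _ = _ := by simp only [mul_assoc]

theorem exists_mul_left_of_mem_ideal [Finite N] {a b y z : N} (h : b = y * (a * b) * z) :
    ∃ x, b = x * (a * b) := by
  have : Finite Nᵐᵒᵖ := Finite.of_equiv N MulOpposite.opEquiv
  obtain ⟨x, hx⟩ := exists_mul_right_of_mem_ideal (N := Nᵐᵒᵖ) (a := .op b) (b := .op a)
    (y := .op z) (z := .op y) (by
      rw [← MulOpposite.op_mul, ← MulOpposite.op_mul, ← MulOpposite.op_mul]
      congr 1
      simpa [mul_assoc] using h)
  refine ⟨x.unop, ?_⟩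
  have := congrArg MulOpposite.unop hx
  simpa using this

/-- The hypotheses make `a`, `b` and `a * b` `J`-equivalent. Stability gives `a = a * b * x` and `b
= t * (a * b)`, and `b * x = t * a` is the idempotent of Clifford and Miller, in the `L`-class of
`a` and the `R`-class of `b`. -/
theorem exists_isLink [Finite N] {a b : N} (ha : idealCard a ≤ idealCard (a * b))
    (hb : idealCard b ≤ idealCard (a * b)) : ∃ F, IsLink a b F := by
  obtain ⟨y, z, h1⟩ := mem_ideal_of_idealCard_le (u := a * b) (v := a) (x := 1) (y := b)
    (by simp) ha
  obtain ⟨y', z', h2⟩ := mem_ideal_of_idealCard_le (u := a * b) (v := b) (x := a) (y := 1)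
    (by simp) hb
  obtain ⟨x, hx⟩ := exists_mul_right_of_mem_ideal h1
  obtain ⟨t, ht⟩ := exists_mul_left_of_mem_ideal h2
  have hF : b * x = t * a := by
    calc b * x = t * (a * b) * x := by rw [← ht]
      _ = t * (a * b * x) := by simp only [mul_assoc]
      _ = t * a := by rw [← hx]
  refine ⟨t * a, ?_, ?_, ?_, ⟨t, rfl⟩⟩
  · calc t * a * (t * a) = t * a * (b * x) := by rw [hF]
      _ = t * (a * b * x) := by simp only [mul_assoc]
      _ = t * a := by rw [← hx]
  · rw [← hF, ← mul_assoc, ← hx]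
  · rw [mul_assoc, ← ht]

/-! ### Covers of bounded complexity for products along smooth lists. -/

variable {X : Type*} [Monoid X]

/-- The properties of a relation `C k w v` ("the element `w` is covered with complexity `k` and
value `v`") from which covers of bounded complexity are obtained. -/
structure IsCover (C : ℕ → X → N → Prop) (φ : N → N) (r : ℕ) : Prop where
  mono : ∀ {k k' w v}, k ≤ k' → C k w v → C k' w v
  mul : ∀ {k w w' v v'}, C k w v → C k w' v' → C (k + 1) (w * w') (v * v')
  loop : ∀ {k k' w z w' a F b}, r ≤ k → F * F = F → a * F = a → F * b = b →
    C k w a → C k' z F → C k w' b → C (k + 2) (w * z * w') (a * φ F * b)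

/-- A list of elements with values such that consecutive values are linked, and the pairs
consisting of a link and of the product of the values before it (starting with `p`) belong to
`Q`. -/
def Smooth (Q : Set (N × N)) : N → List (X × N) → Prop
  | _, [] => True
  | _, [_] => True
  | p, x :: y :: l => (∃ F, IsLink x.2 y.2 F ∧ (F, p * x.2) ∈ Q) ∧ Smooth Q (p * x.2) (y :: l)

/-- The product of the elements of the list. -/
def wordProd (l : List (X × N)) : X := (l.map Prod.fst).prod

/-- The product of the values of the list. -/
def valProd (l : List (X × N)) : N := (l.map Prod.snd).prod

@[simp] theorem wordProd_nil : wordProd ([] : List (X × N)) = 1 := rfl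
@[simp] theorem wordProd_cons (x : X × N) (l : List (X × N)) :
    wordProd (x :: l) = x.1 * wordProd l := by simp [wordProd]
@[simp] theorem wordProd_append (l l' : List (X × N)) :
    wordProd (l ++ l') = wordProd l * wordProd l' := by simp [wordProd]
@[simp] theorem valProd_nil : valProd ([] : List (X × N)) = 1 := rfl
@[simp] theorem valProd_cons (x : X × N) (l : List (X × N)) :
    valProd (x :: l) = x.2 * valProd l := by simp [valProd]

/-- Remove the last state equal to `σ` from a smooth list. -/
theorem Smooth.erase {Q : Set (N × N)} (σ : N × N) : ∀ (l : List (X × N)) (p : N), l ≠ [] →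
    Smooth Q p l → Smooth (Q \ {σ}) p l ∨ ∃ z x tail, l = z ++ x :: tail ∧ z ≠ [] ∧
      p * valProd z = σ.2 ∧ σ.1 * x.2 = x.2 ∧ Smooth (Q \ {σ}) σ.2 (x :: tail)
  | [], _, h, _ => absurd rfl h
  | [_], _, _, _ => Or.inl trivial
  | x :: y :: l, p, _, ⟨⟨F, hF, hQ⟩, h⟩ => by
    -- The rest of the list is searched first, so that the cut is made at the last occurrence of
    -- `σ`.
    rcases Smooth.erase σ (y :: l) (p * x.2) (by simp) h with h' | ⟨z, x', tail, e, _, h1, h2, h3⟩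
    · by_cases hσ : (F, p * x.2) = σ
      · subst hσ
        exact Or.inr ⟨[x], y, l, rfl, by simp, by simp, hF.left, h'⟩
      · exact Or.inl ⟨⟨F, hF, hQ, hσ⟩, h'⟩
    · exact Or.inr ⟨x :: z, x', tail, by simp [e], by simp, by simpa [mul_assoc] using h1, h2, h3⟩

/-- The complexity found here grows with the list; this is harmless because `IsCover.loop` does not
charge the middle factor. -/
theorem IsCover.exists_prod {C : ℕ → X → N → Prop} {φ : N → N} {r : ℕ} (hC : IsCover C φ r)
    {k : ℕ} : ∀ l : List (X × N), l ≠ [] → (∀ x ∈ l, C k x.1 x.2) →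
      ∃ k', C k' (wordProd l) (valProd l)
  | [], h, _ => absurd rfl h
  | [x], _, h => ⟨k, by simpa using h x (by simp)⟩
  | x :: y :: l, _, h => by
    obtain ⟨k', hk'⟩ := hC.exists_prod (y :: l) (by simp) fun x hx => h x (by simp [hx])
    rw [wordProd_cons, valProd_cons]
    exact ⟨_, hC.mul (hC.mono (le_max_left k k') (h x (by simp))) (hC.mono (le_max_right k k') hk')⟩

/-- Induction on the number of allowed states (link, prefix product), at cost 2 per state. If the
first state never returns, the first element is split off. Otherwise the list is cut at the last
return: the product in between is the link `F` itself, and `IsCover.loop` absorbs it at a cost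
independent of its length. The hypothesis on `c` makes the prefix product `L`-equivalent to `x.2`.
The value is kept a right multiple of `x.2`, so that links still fix it and its ideal does not grow.
-/
theorem IsCover.smooth [Finite N] {C : ℕ → X → N → Prop} {φ : N → N} {r : ℕ} (hC : IsCover C φ r)
    {k : ℕ} (hk : r ≤ k) (m : ℕ) : ∀ (Q : Set (N × N)), Q.ncard ≤ m → ∀ (p : N) (x : X × N)
      (l : List (X × N)), (∃ c, c * (p * x.2) = x.2) → Smooth Q p (x :: l) →
      (∀ y ∈ x :: l, C k y.1 y.2) →
      ∃ v t, C (k + 2 * m) (wordProd (x :: l)) v ∧ v = x.2 * t := by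
  induction m with
  | zero =>
    intro Q hQ p x l hp hs hc
    obtain rfl : Q = ∅ := (Set.ncard_eq_zero (Set.toFinite _)).1 (by omega)
    match l, hs with
    | [], _ => exact ⟨x.2, 1, by simpa using hc x (by simp), by simp⟩
    | y :: l, ⟨⟨F, _, h⟩, _⟩ => exact absurd h (by simp)
  | succ m ih =>
    intro Q hQ p x l hp hs hc
    match l, hs with
    | [], _ =>
      exact ⟨x.2, 1, hC.mono (k := k) (by omega) (by simpa using hc x (by simp)), by simp⟩
    | y :: l, ⟨⟨F, hF, hFQ⟩, hs⟩ =>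
      have hcard : (Q \ {(F, p * x.2)}).ncard ≤ m := by
        have := Set.ncard_sdiff_singleton_lt_of_mem hFQ (Set.toFinite _)
        omega
      obtain ⟨c, hc'⟩ := hp
      obtain ⟨d, hd⟩ := hF.ofRight
      have hFp : F = d * c * (p * x.2) := by rw [mul_assoc, hc', hd]
      -- The hypothesis on `c` is inherited by every continuation whose first value is fixed by `F`.
      have inv : ∀ b : N, F * b = b → ∃ c, c * (p * x.2 * b) = b := fun b hb =>
        ⟨d * c, by rw [← mul_assoc, ← hFp, hb]⟩
      have hx : C (k + 2 * m) x.1 x.2 := hC.mono (by omega) (hc x (by simp))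
      rcases hs.erase (F, p * x.2) _ _ (by simp) with h | ⟨z, x', tail, e, hz, h1, h2, h3⟩
      · obtain ⟨v, t, hv, rfl⟩ := ih _ hcard _ y l (inv _ hF.left) h
          fun y' hy' => hc y' (List.mem_cons_of_mem _ hy')
        refine ⟨x.2 * (y.2 * t), _, hC.mono (k := k + 2 * m + 1) (by omega) ?_, rfl⟩
        rw [wordProd_cons]
        exact hC.mul hx hv
      · simp only at h1 h2 h3
        rw [e] at hc
        obtain ⟨v, t, hv, rfl⟩ := ih _ hcard _ x' tail (inv _ h2) h3
          fun y' hy' => hc y' (by simp at hy' ⊢; tauto)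
        obtain ⟨k', hk'⟩ := hC.exists_prod z hz fun y' hy' => hc y' (by simp [hy'])
        -- `F` fixes `valProd z` because `z` begins with `y`, and `F` is a left multiple of the
        -- prefix product, which `valProd z` fixes from the right.
        have hzF : valProd z = F := by
          obtain ⟨z₀, z', rfl⟩ := List.exists_cons_of_ne_nil hz
          obtain rfl : y = z₀ := by simpa using (List.cons.inj e).1
          have e1 : F * valProd (y :: z') = valProd (y :: z') := by
            rw [valProd_cons, ← mul_assoc, hF.left]
          rw [← e1, hFp, mul_assoc, h1]
        rw [hzF] at hk'
        refine ⟨x.2 * φ F * (x'.2 * t), φ F * (x'.2 * t), ?_, by simp only [mul_assoc]⟩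
        rw [e, wordProd_cons, wordProd_append, ← mul_assoc]
        exact hC.loop (k := k + 2 * m) (by omega) hF.idem hF.right (by rw [← mul_assoc, h2]) hx hk' hv

/-- A list of elements is a smooth list followed by a list of elements of smaller ideals. -/
theorem IsCover.reduce [Finite N] {C : ℕ → X → N → Prop} {φ : N → N} {r : ℕ} (hC : IsCover C φ r)
    {k : ℕ} (hk : r ≤ k) (d : ℕ) : ∀ l : List (X × N),
      (∀ x ∈ l, C k x.1 x.2 ∧ idealCard x.2 ≤ d + 1) → ∃ s l' : List (X × N),
        wordProd l = wordProd s * wordProd l' ∧ Smooth Set.univ 1 s ∧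
        (∀ x ∈ s, C k x.1 x.2 ∧ idealCard x.2 ≤ d + 1) ∧
        ∀ x ∈ l', C (k + 2 * (Set.univ : Set (N × N)).ncard + 1) x.1 x.2 ∧ idealCard x.2 ≤ d
  | [], _ => ⟨[], [], by simp, trivial, by simp, by simp⟩
  | x :: l, h => by
    obtain ⟨s, l', e, hs, hs', hl'⟩ := hC.reduce hk d l fun y hy => h y (by simp [hy])
    have hx := h x (by simp)
    -- When all states are allowed, the prefix product plays no role.
    have smooth_congr : ∀ (s : List (X × N)) (p q : N), Smooth Set.univ p s →
        Smooth Set.univ q s := by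
      intro s
      induction s with
      | nil => exact fun _ _ _ => trivial
      | cons a s ih =>
        cases s with
        | nil => exact fun _ _ _ => trivial
        | cons b s => exact fun p q ⟨⟨F, hF, _⟩, h⟩ => ⟨⟨F, hF, trivial⟩, ih _ _ h⟩
    match s, hs, hs', e with
    | [], _, _, e =>
      exact ⟨[x], l', by simp [e], trivial, by simpa using hx, hl'⟩
    | y :: s, hs, hs', e =>
      by_cases hg : ∃ F, IsLink x.2 y.2 F
      · obtain ⟨F, hF⟩ := hg
        refine ⟨x :: y :: s, l', by simp [e, mul_assoc], ⟨⟨F, hF, trivial⟩, smooth_congr _ _ _ hs⟩,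
          ?_, hl'⟩
        intro z hz
        rcases List.mem_cons.1 hz with rfl | hz
        exacts [hx, hs' z hz]
      -- Without a link, `x.2 * y.2` has a smaller ideal than `x.2` or `y.2`. So `x` and the smooth
      -- list collapse into one element, whose value is a right multiple of `x.2 * y.2` and has an
      -- ideal of size at most `d`.
      · obtain ⟨v, t, hv, rfl⟩ := hC.smooth hk _ Set.univ le_rfl 1 y s ⟨1, by simp⟩ hs
          fun z hz => (hs' z hz).1
        refine ⟨[], (x.1 * wordProd (y :: s), x.2 * (y.2 * t)) :: l', by simp [e, mul_assoc],
          trivial, by simp, ?_⟩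
        intro z hz
        rcases List.mem_cons.1 hz with rfl | hz
        · refine ⟨hC.mul (hC.mono (by omega) hx.1) hv, ?_⟩
          by_contra hlt
          refine hg (exists_isLink ?_ ?_)
          · have := idealCard_le (u := x.2 * (y.2 * t)) (v := x.2 * y.2) (x := 1) (y := t)
              (by simp [mul_assoc])
            simp only at hlt
            omega
          · have := idealCard_le (u := x.2 * (y.2 * t)) (v := x.2 * y.2) (x := 1) (y := t)
              (by simp [mul_assoc])
            have := (hs' y (by simp)).2
            simp only at hlt
            omega
        · exact hl' z hz

/-- Products of arbitrarily many covered elements are covered with bounded complexity. -/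
theorem IsCover.exists_bound [Finite N] {C : ℕ → X → N → Prop} {φ : N → N} {r : ℕ}
    (hC : IsCover C φ r) {k₀ : ℕ} (h1 : C k₀ 1 1) (k : ℕ) :
    ∃ K, ∀ l : List (X × N), (∀ x ∈ l, C k x.1 x.2) → ∃ v, C K (wordProd l) v := by
  -- Each round of `reduce` leaves a smooth list, covered at bounded cost, and a list with smaller
  -- ideals; the size of an ideal bounds the number of rounds.
  have main : ∀ d k, r ≤ k → ∃ K, ∀ l : List (X × N),
      (∀ x ∈ l, C k x.1 x.2 ∧ idealCard x.2 ≤ d) → ∃ v, C K (wordProd l) v := by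
    intro d
    induction d with
    | zero =>
      intro k _
      refine ⟨k₀, fun l hl => ⟨1, ?_⟩⟩
      cases l with
      | nil => exact h1
      | cons x l => exact absurd (hl x (by simp)).2 (not_le.2 (idealCard_pos _))
    | succ d ih =>
      intro k hk
      obtain ⟨K, hK⟩ := ih (k + 2 * (Set.univ : Set (N × N)).ncard + 1) (by omega)
      refine ⟨max k₀ (max K (k + 2 * (Set.univ : Set (N × N)).ncard)) + 1, fun l hl => ?_⟩
      obtain ⟨s, l', e, hs, hs', hl'⟩ := hC.reduce hk d l hl
      obtain ⟨v', hv'⟩ := hK l' hl'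
      rw [e]
      have hs'' : ∃ v, C (max k₀ (max K (k + 2 * (Set.univ : Set (N × N)).ncard)))
          (wordProd s) v := by
        cases s with
        | nil => exact ⟨1, hC.mono (by omega) h1⟩
        | cons y s =>
          obtain ⟨v, t, hv, _⟩ := hC.smooth hk _ Set.univ le_rfl 1 y s ⟨1, by simp⟩ hs
            fun z hz => (hs' z hz).1
          exact ⟨v, hC.mono (by omega) hv⟩
      obtain ⟨v, hv⟩ := hs''
      exact ⟨_, hC.mul hv (hC.mono (by omega) hv')⟩
  obtain ⟨K, hK⟩ := main (Nat.card N) (max k r) (by omega)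
  refine ⟨K, fun l hl => hK l fun x hx => ⟨hC.mono (by omega) (hl x hx), ?_⟩⟩
  exact Set.ncard_le_card _

end Factorization

end WordLogic

namespace WordLogic

/-! ### The game preorders on words -/

section Game

variable {A : Type*}

/-- The preorder of the Ehrenfeucht–Fraïssé game for `Σₙ(<)` sentences of quantifier rank at
most `r`: every such sentence that holds in the first word holds in the second word. -/
def GameLE : ℕ → ℕ → List A → List A → Prop
  | 0, _, _, _ => True
  | _ + 1, 0, _, _ => True
  | n + 1, r + 1, w, u => GameLE n (r + 1) u w ∧ ∀ x a x', w = x ++ a :: x' →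
      ∃ y y', u = y ++ a :: y' ∧ GameLE (n + 1) r x y ∧ GameLE (n + 1) r x' y'
termination_by n r => (n, r)

theorem gameLE_zero_left (r : ℕ) (w u : List A) : GameLE 0 r w u := by
  rw [GameLE]; trivial

theorem gameLE_zero_right (n : ℕ) (w u : List A) : GameLE n 0 w u := by
  cases n <;> rw [GameLE] <;> trivial

theorem gameLE_succ {n r : ℕ} {w u : List A} : GameLE (n + 1) (r + 1) w u ↔
    GameLE n (r + 1) u w ∧ ∀ x a x', w = x ++ a :: x' →
      ∃ y y', u = y ++ a :: y' ∧ GameLE (n + 1) r x y ∧ GameLE (n + 1) r x' y' := by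
  rw [GameLE]

/-- Induction along the recursion of `GameLE`. -/
theorem gameInduction {P : ℕ → ℕ → Prop} (h0 : ∀ r, P 0 r) (h1 : ∀ n, P n 0)
    (h2 : ∀ n r, P n (r + 1) → P (n + 1) r → P (n + 1) (r + 1)) : ∀ n r, P n r := by
  intro n
  induction n with
  | zero => exact h0
  | succ n ihn =>
    intro r
    induction r with
    | zero => exact h1 _
    | succ r ihr => exact h2 n r (ihn _) ihr

theorem GameLE.refl (n r : ℕ) : ∀ w : List A, GameLE n r w w := by
  induction n, r using gameInduction with
  | h0 r => exact fun w => gameLE_zero_left ..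
  | h1 n => exact fun w => gameLE_zero_right ..
  | h2 n r ih1 ih2 =>
    exact fun w => gameLE_succ.2 ⟨ih1 w, fun x a x' h => ⟨x, x', h, ih2 _, ih2 _⟩⟩

theorem GameLE.trans {n r : ℕ} : ∀ {w u v : List A}, GameLE n r w u → GameLE n r u v →
    GameLE n r w v := by
  induction n, r using gameInduction with
  | h0 r => exact fun _ _ => gameLE_zero_left ..
  | h1 n => exact fun _ _ => gameLE_zero_right ..
  | h2 n r ih1 ih2 =>
    intro w u v h h'
    rw [gameLE_succ] at h h' ⊢
    refine ⟨ih1 h'.1 h.1, fun x a x' e => ?_⟩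
    obtain ⟨y, y', e', h1, h2⟩ := h.2 x a x' e
    obtain ⟨z, z', e'', h3, h4⟩ := h'.2 y a y' e'
    exact ⟨z, z', e'', ih2 h1 h3, ih2 h2 h4⟩

theorem GameLE.of_succ {n r : ℕ} : ∀ {w u : List A}, GameLE n (r + 1) w u → GameLE n r w u := by
  induction n, r using gameInduction with
  | h0 r => exact fun _ => gameLE_zero_left ..
  | h1 n => exact fun _ => gameLE_zero_right ..
  | h2 n r ih1 ih2 =>
    intro w u h
    rw [gameLE_succ] at h ⊢
    refine ⟨ih1 h.1, fun x a x' e => ?_⟩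
    obtain ⟨y, y', e', h1, h2⟩ := h.2 x a x' e
    exact ⟨y, y', e', ih2 h1, ih2 h2⟩

theorem GameLE.mono {n r r' : ℕ} (hr : r ≤ r') {w u : List A} (h : GameLE n r' w u) :
    GameLE n r w u := by
  induction r', hr using Nat.le_induction with
  | base => exact h
  | succ m _ ih => exact ih h.of_succ

theorem GameLE.dual {n r : ℕ} {w u : List A} (h : GameLE (n + 1) r w u) : GameLE n r u w := by
  cases r with
  | zero => exact gameLE_zero_right ..
  | succ r => exact (gameLE_succ.1 h).1

theorem append_eq_append_cons {x x' y y' : List A} {a : A} (h : x ++ x' = y ++ a :: y') :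
    (∃ t, x = y ++ a :: t ∧ y' = t ++ x') ∨ ∃ t, x' = t ++ a :: y' ∧ y = x ++ t := by
  rcases List.append_eq_append_iff.1 h with ⟨t, h1, h2⟩ | ⟨t, h1, h2⟩
  · exact Or.inr ⟨t, h2, h1⟩
  · cases t with
    | nil => exact Or.inr ⟨[], by simpa using h2.symm, by simpa using h1.symm⟩
    | cons b t =>
      obtain ⟨rfl, rfl⟩ := List.cons.inj h2
      exact Or.inl ⟨t, h1, rfl⟩

/-- A move falls into one factor; the other factor is carried along with its rank lowered by one. -/
theorem GameLE.append {n r : ℕ} : ∀ {x x' y y' : List A}, GameLE n r x y → GameLE n r x' y' →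
    GameLE n r (x ++ x') (y ++ y') := by
  induction n, r using gameInduction with
  | h0 r => exact fun _ _ => gameLE_zero_left ..
  | h1 n => exact fun _ _ => gameLE_zero_right ..
  | h2 n r ih1 ih2 =>
    intro x x' y y' h h'
    refine gameLE_succ.2 ⟨ih1 h.dual h'.dual, fun z a z' e => ?_⟩
    rcases append_eq_append_cons e with ⟨t, rfl, rfl⟩ | ⟨t, rfl, rfl⟩
    · obtain ⟨v, v', rfl, h1, h2⟩ := (gameLE_succ.1 h).2 _ _ _ rfl
      exact ⟨v, v' ++ y', by simp, h1, ih2 h2 h'.of_succ⟩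
    · obtain ⟨v, v', rfl, h1, h2⟩ := (gameLE_succ.1 h').2 _ _ _ rfl
      exact ⟨y ++ v, v', by simp, ih2 h.of_succ h1, h2⟩

/-- The cut is marked by the first letter of `x'`, which costs one round. -/
theorem GameLE.split {n r : ℕ} {x x' u : List A} (h : GameLE (n + 1) (r + 1) (x ++ x') u) :
    ∃ y y', u = y ++ y' ∧ GameLE (n + 1) r x y ∧ GameLE (n + 1) r x' y' := by
  cases x' with
  | nil => exact ⟨u, [], by simp, by simpa using h.of_succ, GameLE.refl ..⟩
  | cons a x' =>
    obtain ⟨y, y', rfl, h1, h2⟩ := (gameLE_succ.1 h).2 _ _ _ rfl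
    exact ⟨y, a :: y', rfl, h1, (GameLE.refl _ _ [a]).append h2⟩

theorem GameLE.mem {n r : ℕ} {w u : List A} (h : GameLE (n + 1) (r + 1) w u) {a : A}
    (ha : a ∈ w) : a ∈ u := by
  obtain ⟨x, x', rfl⟩ := List.append_of_mem ha
  obtain ⟨y, y', rfl, _⟩ := (gameLE_succ.1 h).2 _ _ _ rfl
  simp

theorem GameLE.mem_iff {n r : ℕ} {w u : List A} (h : GameLE (n + 2) (r + 1) w u) {a : A} :
    a ∈ w ↔ a ∈ u :=
  ⟨h.mem, h.dual.mem⟩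

theorem GameLE.eq_nil {n r : ℕ} {u : List A} (h : GameLE (n + 2) (r + 1) [] u) : u = [] := by
  refine List.eq_nil_iff_forall_not_mem.2 fun a ha => ?_
  simpa using h.mem_iff.2 ha

/-- One round places the letter, a second one shows that nothing stands beside it. -/
theorem GameLE.eq_singleton {n r : ℕ} {a : A} {u : List A} (h : GameLE (n + 2) (r + 2) [a] u) :
    u = [a] := by
  obtain ⟨y, y', rfl, h1, h2⟩ := (gameLE_succ.1 h).2 [] a [] rfl
  rw [h1.eq_nil, h2.eq_nil, List.nil_append]

/-- The power `w ^ i` of a word. -/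
def wordPow (w : List A) : ℕ → List A
  | 0 => []
  | i + 1 => w ++ wordPow w i

theorem wordPow_add (w : List A) (i j : ℕ) : wordPow w (i + j) = wordPow w i ++ wordPow w j := by
  induction i with
  | zero => simp [wordPow]
  | succ i ih => rw [Nat.succ_add, wordPow, ih, wordPow, List.append_assoc]

theorem wordPow_split (w : List A) (i j : ℕ) :
    wordPow w (i + 1 + j) = wordPow w i ++ w ++ wordPow w j := by
  rw [wordPow_add, wordPow_add]
  simp [wordPow]

theorem wordPow_eq_append_cons {w : List A} {x x' : List A} {a : A} : ∀ {i : ℕ},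
    wordPow w i = x ++ a :: x' → ∃ j l t t', i = j + 1 + l ∧ w = t ++ a :: t' ∧
      x = wordPow w j ++ t ∧ x' = t' ++ wordPow w l
  | 0, h => by simp [wordPow] at h
  | i + 1, h => by
    rcases append_eq_append_cons (x := w) h with ⟨t, h1, h2⟩ | ⟨t, h1, h2⟩
    · exact ⟨0, i, x, t, by omega, h1, by simp [wordPow], h2⟩
    · obtain ⟨j, l, s, s', rfl, h3, h4, h5⟩ := wordPow_eq_append_cons h1
      exact ⟨j + 1, l, s, s', by omega, h3, by simp [h2, h4, wordPow], h5⟩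

/-- The strategy for choosing a block in a power: a side with fewer than `m` blocks is copied
exactly, a longer side is answered by a side with at least `m` blocks. The threshold `2 * m + 1`
leaves room for both. -/
theorem exists_split_exponent {m i j l : ℕ} (hi : 2 * m + 1 ≤ i) (e : i = j + 1 + l) (i' : ℕ)
    (hi' : 2 * m + 1 ≤ i') : ∃ j' l', i' = j' + 1 + l' ∧
      (j = j' ∨ m ≤ j ∧ m ≤ j') ∧ (l = l' ∨ m ≤ l ∧ m ≤ l') := by
  by_cases hj : m ≤ j
  · by_cases hl : m ≤ l
    · exact ⟨m, i' - 1 - m, by omega, by omega, by omega⟩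
    · exact ⟨i' - 1 - l, l, by omega, by omega, by omega⟩
  · exact ⟨j, i' - 1 - j, by omega, by omega, by omega⟩

/-- Powers of a word with large exponents are equivalent. -/
theorem gameLE_wordPow (w : List A) (n r : ℕ) : ∀ i j, 2 ^ r - 1 ≤ i → 2 ^ r - 1 ≤ j →
    GameLE n r (wordPow w i) (wordPow w j) := by
  induction n, r using gameInduction with
  | h0 r => exact fun _ _ _ _ => gameLE_zero_left ..
  | h1 n => exact fun _ _ _ _ => gameLE_zero_right ..
  | h2 n r ih1 ih2 =>
    intro i j hi hj
    refine gameLE_succ.2 ⟨ih1 j i hj hi, fun x a x' e => ?_⟩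
    -- The threshold `2 ^ r - 1` is the solution of the recursion `m ↦ 2 * m + 1` imposed by
    -- `exists_split_exponent`.
    have h2 : 2 ^ (r + 1) - 1 = 2 * (2 ^ r - 1) + 1 := by
      have := Nat.one_le_two_pow (n := r)
      rw [pow_succ]; omega
    rw [h2] at hi hj
    have ih : ∀ p q, p = q ∨ 2 ^ r - 1 ≤ p ∧ 2 ^ r - 1 ≤ q →
        GameLE (n + 1) r (wordPow w p) (wordPow w q) := by
      rintro p q (rfl | ⟨hp, hq⟩)
      exacts [GameLE.refl .., ih2 p q hp hq]
    obtain ⟨p, q, t, t', e1, e2, rfl, rfl⟩ := wordPow_eq_append_cons e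
    obtain ⟨p', q', rfl, hp, hq⟩ := exists_split_exponent hi e1 j hj
    refine ⟨wordPow w p' ++ t, t' ++ wordPow w q', ?_, (ih _ _ hp).append (GameLE.refl ..),
      (GameLE.refl ..).append (ih _ _ hq)⟩
    rw [wordPow_split]
    nth_rewrite 2 [e2]
    simp

/-- A smaller word can be inserted into a large power. -/
theorem gameLE_insert {n : ℕ} {w u : List A} (r : ℕ) (h : GameLE n r u w) : ∀ i j l,
    2 ^ r - 1 ≤ i → 2 ^ r - 1 ≤ j → 2 ^ r - 1 ≤ l →
    GameLE (n + 1) r (wordPow w i) (wordPow w j ++ u ++ wordPow w l) := by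
  induction r with
  | zero => exact fun _ _ _ _ _ _ => gameLE_zero_right ..
  | succ r ih =>
    intro i j l hi hj hl
    have h2 : 2 ^ (r + 1) - 1 = 2 * (2 ^ r - 1) + 1 := by
      have := Nat.one_le_two_pow (n := r)
      rw [pow_succ]; omega
    refine gameLE_succ.2 ⟨?_, fun x a x' e => ?_⟩
    -- In the dual direction, replacing `u` by the larger `w` gives a pure power of `w`.
    · refine (((GameLE.refl n (r + 1) (wordPow w j)).append h).append (GameLE.refl ..)).trans ?_
      rw [← wordPow_split]
      exact gameLE_wordPow _ _ _ _ _ (by omega) hi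
    rw [h2] at hi hj hl
    obtain ⟨p, q, t, t', rfl, e2, rfl, rfl⟩ := wordPow_eq_append_cons e
    have key : ∀ p' q', wordPow w (p' + 1 + q') = wordPow w p' ++ t ++ a :: (t' ++ wordPow w q') := by
      intro p' q'
      rw [wordPow_split]
      nth_rewrite 2 [e2]
      simp
    -- If many blocks follow the chosen one, the answer lies before `u`; otherwise it lies after
    -- `u`, with exactly `q` blocks behind it.
    by_cases hq : 2 ^ r - 1 ≤ q
    · obtain ⟨p', q', rfl, hp', hq'⟩ := exists_split_exponent (m := 2 ^ r - 1) hi rfl j hj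
      refine ⟨wordPow w p' ++ t, t' ++ (wordPow w q' ++ u ++ wordPow w l), ?_, ?_, ?_⟩
      · rw [key]; simp
      · refine GameLE.append ?_ (GameLE.refl ..)
        rcases hp' with rfl | ⟨h3, h4⟩
        exacts [GameLE.refl .., gameLE_wordPow _ _ _ _ _ h3 h4]
      · exact (GameLE.refl ..).append (ih h.of_succ _ _ _ hq (by omega) (by omega))
    · refine ⟨wordPow w j ++ u ++ wordPow w (l - 1 - q) ++ t, t' ++ wordPow w q, ?_, ?_,
        GameLE.refl ..⟩
      · obtain ⟨s, rfl⟩ : ∃ s, l = s + 1 + q := ⟨l - 1 - q, by omega⟩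
        rw [key, show s + 1 + q - 1 - q = s by omega]
        simp
      · exact (ih h.of_succ _ _ _ (by omega) (by omega) (by omega)).append (GameLE.refl ..)

/-- A word over the letters of `w` is below large powers of `w` for `Σ₁(<)`. -/
theorem gameLE_one_wordPow {w : List A} (r : ℕ) : ∀ {u : List A}, (∀ a ∈ u, a ∈ w) →
    ∀ i, 2 ^ r - 1 ≤ i → GameLE 1 r u (wordPow w i) := by
  induction r with
  | zero => exact fun _ _ _ => gameLE_zero_right ..
  | succ r ih =>
    intro u h i hi
    refine gameLE_succ.2 ⟨gameLE_zero_left .., fun x a x' e => ?_⟩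
    subst e
    have h2 : 2 ^ (r + 1) - 1 = 2 * (2 ^ r - 1) + 1 := by
      have := Nat.one_le_two_pow (n := r)
      rw [pow_succ]; omega
    obtain ⟨t, t', e⟩ := List.append_of_mem (h a (by simp))
    -- The answer is given in a middle block, so that the powers on both sides remain long enough
    -- for rank `r`.
    obtain ⟨s, rfl⟩ : ∃ s, i = (2 ^ r - 1) + 1 + s := ⟨i - 2 ^ r, by omega⟩
    have nil_le : ∀ v : List A, GameLE 1 r [] v := fun v => by
      cases r with
      | zero => exact gameLE_zero_right ..
      | succ r => exact gameLE_succ.2 ⟨gameLE_zero_left .., fun x a x' e => by simp at e⟩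
    refine ⟨wordPow w (2 ^ r - 1) ++ t, t' ++ wordPow w s, ?_, ?_, ?_⟩
    · rw [wordPow_split]
      nth_rewrite 2 [e]
      simp
    · simpa using (ih (fun b hb => h b (by simp [hb])) _ le_rfl).append (nil_le t)
    · simpa using (nil_le t').append (ih (u := x') (fun b hb => h b (by simp [hb])) s (by omega))

end Game

end WordLogic

namespace WordLogic

/-! ### Games and formulas -/

section Logic

open FirstOrder FirstOrder.Language

variable {A : Type}

/-- A position of the game on two words in which the positions listed in the third argument have
been chosen. -/
inductive Match (n r : ℕ) : List A → List A → List (ℕ × ℕ) → Prop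
  | nil {w u : List A} (h : GameLE n r w u) : Match n r w u []
  | cons {x y w u : List A} {a : A} {ps : List (ℕ × ℕ)} (h : GameLE n r x y)
      (h' : Match n r w u ps) : Match n r (x ++ a :: w) (y ++ a :: u)
        ((x.length, y.length) :: ps.map fun p => (x.length + 1 + p.1, y.length + 1 + p.2))

theorem Match.mono {n r r' : ℕ} (hr : r ≤ r') {w u : List A} {ps : List (ℕ × ℕ)}
    (h : Match n r' w u ps) : Match n r w u ps := by
  induction h with
  | nil h => exact .nil (h.mono hr)
  | cons h _ ih => exact .cons (h.mono hr) ih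

theorem Match.dual {n r : ℕ} {w u : List A} {ps : List (ℕ × ℕ)} (h : Match (n + 1) r w u ps) :
    Match n r u w (ps.map Prod.swap) := by
  induction h with
  | nil h => exact .nil h.dual
  | cons h _ ih =>
    have := Match.cons (a := by assumption) h.dual ih
    simpa [Function.comp_def] using this

theorem Match.getElem? {n r : ℕ} {w u : List A} {ps : List (ℕ × ℕ)} (h : Match n r w u ps) :
    ∀ p ∈ ps, w[p.1]? = u[p.2]? := by
  induction h with
  | nil h => simp
  | cons h _ ih =>
    intro p hp
    rcases List.mem_cons.1 hp with rfl | hp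
    · simp
    · obtain ⟨q, hq, rfl⟩ := List.mem_map.1 hp
      have := ih q hq
      rw [List.getElem?_append_right (by omega), List.getElem?_append_right (by omega)]
      simpa [show ∀ a b : ℕ, a + 1 + b - a = b + 1 by omega] using this

theorem Match.lt_iff {n r : ℕ} {w u : List A} {ps : List (ℕ × ℕ)} (h : Match n r w u ps) :
    ∀ p ∈ ps, ∀ q ∈ ps, p.1 < q.1 ↔ p.2 < q.2 := by
  induction h with
  | nil h => simp
  | cons h _ ih =>
    intro p hp q hq
    rcases List.mem_cons.1 hp with rfl | hp <;> rcases List.mem_cons.1 hq with rfl | hq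
    · simp
    · obtain ⟨q, hq, rfl⟩ := List.mem_map.1 hq
      simp only; omega
    · obtain ⟨p, hp, rfl⟩ := List.mem_map.1 hp
      simp only; omega
    · obtain ⟨p', hp', rfl⟩ := List.mem_map.1 hp
      obtain ⟨q', hq', rfl⟩ := List.mem_map.1 hq
      have := ih p' hp' q' hq'
      simp only; omega

theorem exists_append_cons {w : List A} {p : ℕ} (hp : p < w.length) :
    ∃ x a x', w = x ++ a :: x' ∧ x.length = p :=
  ⟨w.take p, w[p], w.drop (p + 1), by simp, by simp; omega⟩

/-- Chosen positions cut the words into factors that are compared separately. A new position is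
either an old one or lies inside a single factor, where `GameLE` provides the answer. -/
theorem Match.extend {n r : ℕ} {w u : List A} {ps : List (ℕ × ℕ)}
    (h : Match (n + 1) (r + 1) w u ps) : ∀ p < w.length, ∃ q < u.length, ∃ qs,
      Match (n + 1) r w u qs ∧ (p, q) ∈ qs ∧ ps ⊆ qs := by
  induction h with
  | @nil w u h =>
    intro p hp
    obtain ⟨x, a, x', rfl, rfl⟩ := exists_append_cons hp
    obtain ⟨y, y', rfl, h1, h2⟩ := (gameLE_succ.1 h).2 _ _ _ rfl
    exact ⟨y.length, by simp, _, .cons h1 (.nil h2), by simp, by simp⟩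
  | @cons x y w u a ps h h' ih =>
    intro p hp
    rcases lt_trichotomy p x.length with hlt | rfl | hlt
    · obtain ⟨x₁, b, x₂, rfl, rfl⟩ := exists_append_cons hlt
      obtain ⟨y₁, y₂, rfl, h1, h2⟩ := (gameLE_succ.1 h).2 _ _ _ rfl
      have := Match.cons (a := b) h1 (Match.cons (a := a) h2 (h'.mono (Nat.le_succ r)))
      refine ⟨y₁.length, by simp, _, by simpa only [List.append_assoc, List.cons_append] using this,
        by simp, ?_⟩
      intro q hq
      rcases List.mem_cons.1 hq with rfl | hq
      · simp; omega
      · obtain ⟨q, hq', rfl⟩ := List.mem_map.1 hq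
        refine List.mem_cons_of_mem _ (List.mem_map.2 ⟨_, List.mem_cons_of_mem _
          (List.mem_map.2 ⟨q, hq', rfl⟩), ?_⟩)
        simp; omega
    · exact ⟨y.length, by simp, _, .cons h.of_succ (h'.mono (Nat.le_succ r)), by simp, by simp⟩
    · obtain ⟨p, rfl⟩ : ∃ t, p = x.length + 1 + t := ⟨p - x.length - 1, by omega⟩
      simp only [List.length_append, List.length_cons] at hp
      obtain ⟨q, hq, qs, h1, h2, h3⟩ := ih p (by omega)
      refine ⟨y.length + 1 + q, by simp; omega, _, .cons h.of_succ h1, ?_, ?_⟩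
      · exact List.mem_cons_of_mem _ (List.mem_map.2 ⟨_, h2, rfl⟩)
      · exact List.cons_subset_cons _ (List.map_subset _ h3)

attribute [local instance] wordStructure

/-- The implication between two propositions in the direction given by the quantifier. -/
def Transfer : Quantifier → Prop → Prop → Prop
  | .ex, P, P' => P → P'
  | .all, P, P' => P' → P

theorem Transfer.of_iff {Q : Quantifier} {P P' : Prop} (h : P ↔ P') : Transfer Q P P' := by
  cases Q
  exacts [h.1, h.2]

theorem Transfer.imp {Q : Quantifier} {P P' R R' : Prop} (h : Transfer Q.dual P P')
    (h' : Transfer Q R R') : Transfer Q (P → R) (P' → R') := by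
  cases Q
  exacts [fun f p => h' (f (h p)), fun f p => h' (f (h p))]

theorem exists_eq_var {m : ℕ} : ∀ t : (wordLang A).Term (Empty ⊕ Fin m),
    ∃ i : Fin m, t = Term.var (Sum.inr i)
  | .var (.inl e) => e.elim
  | .var (.inr i) => ⟨i, rfl⟩
  | .func f _ => Empty.elim f

theorem isQF_realize_iff {m : ℕ} {φ : (wordLang A).BoundedFormula Empty m} (h : φ.IsQF) {n r : ℕ}
    {w u : List A} {ps : List (ℕ × ℕ)} (hm : Match n r w u ps) {v : Empty → Fin w.length}
    {v' : Empty → Fin u.length} {xs : Fin m → Fin w.length} {ys : Fin m → Fin u.length}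
    (hp : ∀ i, ((xs i : ℕ), (ys i : ℕ)) ∈ ps) : φ.Realize v xs ↔ φ.Realize v' ys := by
  have hlt : ∀ i j, xs i < xs j ↔ ys i < ys j := fun i j => hm.lt_iff _ (hp i) _ (hp j)
  induction h with
  | falsum => exact Iff.rfl
  | of_isAtomic h =>
    cases h with
    | equal t₁ t₂ =>
      obtain ⟨i, rfl⟩ := exists_eq_var t₁
      obtain ⟨j, rfl⟩ := exists_eq_var t₂
      simp only [BoundedFormula.realize_bdEqual, Term.realize_var, Sum.elim_inr]
      have h1 := hlt i j
      have h2 := hlt j i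
      -- The order is total, so equality of positions is decided by `<`.
      rw [← not_iff_not, ← ne_eq, ← ne_eq, lt_or_lt_iff_ne.symm, lt_or_lt_iff_ne.symm, h1, h2]
    | rel R ts =>
      rw [BoundedFormula.realize_rel, BoundedFormula.realize_rel]
      cases R with
      | letter a =>
        obtain ⟨i, hi⟩ := exists_eq_var (ts 0)
        have := hm.getElem? _ (hp i)
        simp only [Structure.RelMap, hi, Term.realize_var, Sum.elim_inr]
        simp only [List.getElem?_eq_getElem, Fin.is_lt, Option.some.injEq] at this
        simp [this]
      | lt =>
        obtain ⟨i, hi⟩ := exists_eq_var (ts 0)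
        obtain ⟨j, hj⟩ := exists_eq_var (ts 1)
        simp only [Structure.RelMap, hi, hj, Term.realize_var, Sum.elim_inr]
        exact hlt i j
  | imp _ _ ih1 ih2 =>
    rw [BoundedFormula.realize_imp, BoundedFormula.realize_imp]
    exact imp_congr ih1 ih2

/-- Formulas of level `n` are preserved in the game with `n` alternations. -/
theorem HasLevel.exists_transfer {Q : Quantifier} {n m : ℕ}
    {φ : (wordLang A).BoundedFormula Empty m} (h : HasLevel Q n φ) :
    ∃ r, ∀ (w u : List A) (ps : List (ℕ × ℕ)), Match n r w u ps → ∀ (v : Empty → Fin w.length)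
      (v' : Empty → Fin u.length) (xs : Fin m → Fin w.length) (ys : Fin m → Fin u.length),
      (∀ i, ((xs i : ℕ), (ys i : ℕ)) ∈ ps) → Transfer Q (φ.Realize v xs) (φ.Realize v' ys) := by
  induction h with
  | qf h => exact ⟨0, fun w u ps hm v v' xs ys hp => .of_iff (isQF_realize_iff h hm hp)⟩
  | imp _ _ ih1 ih2 =>
    obtain ⟨r₁, h1⟩ := ih1
    obtain ⟨r₂, h2⟩ := ih2
    refine ⟨max r₁ r₂, fun w u ps hm v v' xs ys hp => ?_⟩
    rw [BoundedFormula.realize_imp, BoundedFormula.realize_imp]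
    exact (h1 _ _ _ (hm.mono (le_max_left ..)) _ _ _ _ hp).imp
      (h2 _ _ _ (hm.mono (le_max_right ..)) _ _ _ _ hp)
  | all _ ih =>
    obtain ⟨r, h⟩ := ih
    refine ⟨r + 1, fun w u ps hm v v' xs ys hp => ?_⟩
    rw [BoundedFormula.realize_all, BoundedFormula.realize_all]
    intro H p
    -- Universal formulas are transferred from `u` to `w`: the position is chosen in `w` and
    -- answered in `u`, at the cost of one round.
    obtain ⟨q, hq, qs, hm', h1, h2⟩ := hm.extend p p.2
    refine h w u qs hm' v v' (Fin.snoc xs p) (Fin.snoc ys ⟨q, hq⟩) (fun i => ?_) (H ⟨q, hq⟩)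
    induction i using Fin.lastCases with
    | last => simpa using h1
    | cast i => simpa using h2 (hp i)
  | @next Q i m φ _ ih =>
    obtain ⟨r, h⟩ := ih
    refine ⟨r, fun w u ps hm v v' xs ys hp => ?_⟩
    -- A change of level exchanges the two words and costs no rank.
    have := h u w _ hm.dual v' v ys xs fun i => List.mem_map.2 ⟨_, hp i, rfl⟩
    cases Q <;> exact this

/-- The decompositions `w = x ++ a :: x'` of a word. -/
def splits : List A → List (List A × A × List A)
  | [] => []
  | a :: w => ([], a, w) :: (splits w).map fun s => (a :: s.1, s.2)

theorem mem_splits {w : List A} : ∀ {s : List A × A × List A},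
    s ∈ splits w ↔ w = s.1 ++ s.2.1 :: s.2.2 := by
  induction w with
  | nil => intro s; simp [splits]
  | cons b w ih =>
    rintro ⟨x, a, x'⟩
    cases x with
    | nil => simp [splits, eq_comm]
    | cons c x =>
      simp only [splits, List.mem_cons, Prod.mk.injEq, reduceCtorEq, false_and, List.mem_map, ih,
        List.cons.injEq, false_or, List.cons_append]
      constructor
      · rintro ⟨⟨y, d, y'⟩, h, ⟨rfl, rfl⟩, h'⟩
        simp only [Prod.mk.injEq] at h'
        obtain ⟨rfl, rfl⟩ := h'
        exact ⟨rfl, h⟩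
      · rintro ⟨rfl, h⟩
        exact ⟨(x, a, x'), h, ⟨rfl, rfl⟩, rfl⟩

/-- The order symbol. -/
def ltRel : (wordLang A).Relations 2 := WordRel.lt

/-- The symbol of the letter `a`. -/
def letterRel (a : A) : (wordLang A).Relations 1 := WordRel.letter a

/-- The formula `x_i < x_j`. -/
def ltFormula {m : ℕ} (i j : Fin m) : (wordLang A).BoundedFormula Empty m :=
  ltRel.boundedFormula₂ (.var (.inr i)) (.var (.inr j))

/-- The formula `P_a(x_i)`. -/
def letterFormula {m : ℕ} (a : A) (i : Fin m) : (wordLang A).BoundedFormula Empty m :=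
  (letterRel a).boundedFormula₁ (.var (.inr i))

/-- The disjunction of a list of formulas. -/
def listSup {m : ℕ} (l : List ((wordLang A).BoundedFormula Empty m)) :
    (wordLang A).BoundedFormula Empty m := l.foldr (· ⊔ ·) ⊥

/-- The conjunction of a list of formulas. -/
def listInf {m : ℕ} (l : List ((wordLang A).BoundedFormula Empty m)) :
    (wordLang A).BoundedFormula Empty m := l.foldr (· ⊓ ·) ⊤

/-- The formula saying that the last variable is strictly between the given ends. -/
def between {m : ℕ} (lo hi : Option (Fin m)) : (wordLang A).BoundedFormula Empty (m + 1) :=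
  lo.elim ⊤ (fun i => ltFormula i.castSucc (Fin.last m)) ⊓
    hi.elim ⊤ (fun j => ltFormula (Fin.last m) j.castSucc)

/-- The formula saying that the word `w` is below (for `Quantifier.ex`) or above (for
`Quantifier.all`) the factor strictly between the given ends, for the preorder `GameLE n r`. -/
def gameFormula : Quantifier → ℕ → ℕ → List A → {m : ℕ} → Option (Fin m) → Option (Fin m) →
    (wordLang A).BoundedFormula Empty m
  | _, 0, _, _, _, _, _ => ⊤
  | _, _ + 1, 0, _, _, _, _ => ⊤
  | .ex, n + 1, r + 1, w, m, lo, hi => gameFormula .all n (r + 1) w lo hi ⊓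
      listInf ((splits w).map fun s => (between lo hi ⊓ (letterFormula s.2.1 (Fin.last m) ⊓
        (gameFormula .ex (n + 1) r s.1 (lo.map Fin.castSucc) (some (Fin.last m)) ⊓
        gameFormula .ex (n + 1) r s.2.2 (some (Fin.last m)) (hi.map Fin.castSucc)))).ex)
  | .all, n + 1, r + 1, w, m, lo, hi => gameFormula .ex n (r + 1) w lo hi ⊓
      ((between lo hi).imp (listSup ((splits w).map fun s => letterFormula s.2.1 (Fin.last m) ⊓
        (gameFormula .all (n + 1) r s.1 (lo.map Fin.castSucc) (some (Fin.last m)) ⊓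
        gameFormula .all (n + 1) r s.2.2 (some (Fin.last m)) (hi.map Fin.castSucc))))).all
termination_by _ n r => (n, r)

/-! ### Levels of the connectives and of `gameFormula`. -/

section Level

variable {Q : Quantifier} {i m : ℕ} {φ ψ : (wordLang A).BoundedFormula Empty m}

theorem Quantifier.dual_dual (Q : Quantifier) : Q.dual.dual = Q := by cases Q <;> rfl

theorem HasLevel.not (h : HasLevel Q.dual i φ) : HasLevel Q i φ.not := h.imp (.qf BoundedFormula.isQF_bot)

theorem HasLevel.inf (h : HasLevel Q i φ) (h' : HasLevel Q i ψ) : HasLevel Q i (φ ⊓ ψ) := by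
  refine HasLevel.not (.imp ?_ (HasLevel.not ?_)) <;> rwa [Quantifier.dual_dual]

theorem HasLevel.sup (h : HasLevel Q i φ) (h' : HasLevel Q i ψ) : HasLevel Q i (φ ⊔ ψ) := by
  refine .imp (HasLevel.not ?_) h'
  rwa [Quantifier.dual_dual]

theorem HasLevel.listInf : ∀ {l : List ((wordLang A).BoundedFormula Empty m)},
    (∀ φ ∈ l, HasLevel Q i φ) → HasLevel Q i (listInf l)
  | [], _ => .qf .top
  | φ :: l, h => (h φ (by simp)).inf (HasLevel.listInf fun ψ hψ => h ψ (by simp [hψ]))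

theorem HasLevel.listSup : ∀ {l : List ((wordLang A).BoundedFormula Empty m)},
    (∀ φ ∈ l, HasLevel Q i φ) → HasLevel Q i (listSup l)
  | [], _ => .qf BoundedFormula.isQF_bot
  | φ :: l, h => (h φ (by simp)).sup (HasLevel.listSup fun ψ hψ => h ψ (by simp [hψ]))

theorem HasLevel.ex {φ : (wordLang A).BoundedFormula Empty (m + 1)}
    (h : HasLevel .ex (i + 1) φ) : HasLevel .ex (i + 1) φ.ex :=
  HasLevel.not (.all (HasLevel.not h))

theorem isQF_between {lo hi : Option (Fin m)} :
    (between lo hi : (wordLang A).BoundedFormula Empty (m + 1)).IsQF := by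
  refine BoundedFormula.IsQF.inf ?_ ?_
  · cases lo
    exacts [.top, (BoundedFormula.IsAtomic.rel _ _).isQF]
  · cases hi
    exacts [.top, (BoundedFormula.IsAtomic.rel _ _).isQF]

theorem isQF_letterFormula {a : A} {j : Fin m} :
    (letterFormula a j : (wordLang A).BoundedFormula Empty m).IsQF :=
  (BoundedFormula.IsAtomic.rel _ _).isQF

end Level

theorem hasLevel_gameFormula (n r : ℕ) : ∀ (Q : Quantifier) (w : List A) {m : ℕ}
    (lo hi : Option (Fin m)), HasLevel Q n (gameFormula Q n r w lo hi) := by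
  induction n, r using gameInduction with
  | h0 r => intro Q w m lo hi; rw [gameFormula]; exact .qf .top
  | h1 n => intro Q w m lo hi; cases n <;> rw [gameFormula] <;> exact .qf .top
  | h2 n r ih1 ih2 =>
    intro Q w m lo hi
    cases Q with
    | ex =>
      rw [gameFormula]
      refine (HasLevel.next (Q := .ex) (ih1 .all ..)).inf (HasLevel.listInf fun φ hφ => ?_)
      obtain ⟨s, _, rfl⟩ := List.mem_map.1 hφ
      exact HasLevel.ex ((HasLevel.qf isQF_between).inf ((HasLevel.qf isQF_letterFormula).inf
        ((ih2 ..).inf (ih2 ..))))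
    | all =>
      rw [gameFormula]
      refine (HasLevel.next (Q := .all) (ih1 .ex ..)).inf (.all (.imp (.qf isQF_between)
        (HasLevel.listSup fun φ hφ => ?_)))
      obtain ⟨s, _, rfl⟩ := List.mem_map.1 hφ
      exact (HasLevel.qf isQF_letterFormula).inf ((ih2 ..).inf (ih2 ..))

/-! ### Meaning of `gameFormula` on factors of a word. -/

section Realize

variable {m : ℕ} {u : List A} {v : Empty → Fin u.length} {xs : Fin m → Fin u.length}

theorem realize_listSup {l : List ((wordLang A).BoundedFormula Empty m)} :
    (listSup l).Realize v xs ↔ ∃ φ ∈ l, φ.Realize v xs := by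
  induction l with
  | nil => simp [listSup]
  | cons φ l ih =>
    have : listSup (φ :: l) = φ ⊔ listSup l := rfl
    simp [this, BoundedFormula.realize_sup, ih]

theorem realize_listSup_map {ι : Type} {l : List ι}
    {f : ι → (wordLang A).BoundedFormula Empty m} :
    (listSup (l.map f)).Realize v xs ↔ ∃ s ∈ l, (f s).Realize v xs := by
  simp [realize_listSup]

theorem realize_listInf {l : List ((wordLang A).BoundedFormula Empty m)} :
    (listInf l).Realize v xs ↔ ∀ φ ∈ l, φ.Realize v xs := by
  induction l with
  | nil => simp [listInf]
  | cons φ l ih =>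
    have : listInf (φ :: l) = φ ⊓ listInf l := rfl
    simp [this, BoundedFormula.realize_inf, ih]

theorem realize_ltFormula {i j : Fin m} :
    (ltFormula i j : (wordLang A).BoundedFormula Empty m).Realize v xs ↔ xs i < xs j := by
  rw [ltFormula, BoundedFormula.realize_rel₂]
  exact Iff.rfl

theorem realize_letterFormula {a : A} {i : Fin m} :
    (letterFormula a i : (wordLang A).BoundedFormula Empty m).Realize v xs ↔
      u.get (xs i) = a := by
  rw [letterFormula, BoundedFormula.realize_rel₁]
  exact Iff.rfl

/-- The first position after the left end. -/
def startPos (xs : Fin m → Fin u.length) (lo : Option (Fin m)) : ℕ :=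
  lo.elim 0 fun i => xs i + 1

/-- The right end. -/
def stopPos (xs : Fin m → Fin u.length) (hi : Option (Fin m)) : ℕ :=
  hi.elim u.length fun i => xs i

theorem stopPos_le (hi : Option (Fin m)) : stopPos xs hi ≤ u.length := by
  cases hi
  exacts [le_rfl, (xs _).2.le]

theorem realize_between {lo hi : Option (Fin m)} {p : Fin u.length} :
    (between lo hi : (wordLang A).BoundedFormula Empty (m + 1)).Realize v (Fin.snoc xs p) ↔
      startPos xs lo ≤ p ∧ p < stopPos xs hi := by
  rw [between, BoundedFormula.realize_inf]
  refine and_congr ?_ ?_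
  · cases lo with
    | none => simp [startPos]
    | some i =>
      simp [startPos, realize_ltFormula]
  · cases hi with
    | none => simp [stopPos]
    | some i => simp [stopPos, realize_ltFormula]

@[simp] theorem startPos_castSucc (lo : Option (Fin m)) (p : Fin u.length) :
    startPos (Fin.snoc xs p : Fin (m + 1) → Fin u.length) (lo.map Fin.castSucc) =
      startPos xs lo := by
  cases lo <;> simp [startPos]

@[simp] theorem stopPos_castSucc (hi : Option (Fin m)) (p : Fin u.length) :
    stopPos (Fin.snoc xs p : Fin (m + 1) → Fin u.length) (hi.map Fin.castSucc) =
      stopPos xs hi := by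
  cases hi <;> simp [stopPos]

@[simp] theorem startPos_last (p : Fin u.length) :
    startPos (Fin.snoc xs p : Fin (m + 1) → Fin u.length) (some (Fin.last m)) = p + 1 := by
  simp [startPos]

@[simp] theorem stopPos_last (p : Fin u.length) :
    stopPos (Fin.snoc xs p : Fin (m + 1) → Fin u.length) (some (Fin.last m)) = p := by
  simp [stopPos]

/-- The factor of `u` between two positions. -/
def factor (u : List A) (s t : ℕ) : List A := (u.take t).drop s

theorem factor_eq {u : List A} {s t : ℕ} {p : Fin u.length} (h1 : s ≤ p) (h2 : p < t) :
    factor u s t = factor u s p ++ u.get p :: factor u (p + 1) t := by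
  have h3 : u.take t = u.take p ++ u.get p :: (u.take t).drop (p + 1) := by
    have h4 : p < (u.take t).length := by simp [h2]
    conv_lhs => rw [← List.take_append_drop p (u.take t), List.drop_eq_getElem_cons h4]
    rw [List.take_take, min_eq_left h2.le]
    simp
  rw [factor, h3, List.drop_append_of_le_length (by simp [h1, p.2.le])]
  rfl

theorem factor_eq_append_cons {u : List A} {s t : ℕ} (ht : t ≤ u.length) {y y' : List A} {a : A} :
    factor u s t = y ++ a :: y' ↔ ∃ p : Fin u.length, (s ≤ p ∧ p < t) ∧ u.get p = a ∧
      y = factor u s p ∧ y' = factor u (p + 1) t := by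
  constructor
  · intro h
    have hl := congrArg List.length h
    simp only [factor, List.length_drop, List.length_take, List.length_append,
      List.length_cons, min_eq_left ht] at hl
    let p : Fin u.length := ⟨s + y.length, by omega⟩
    have hp : s ≤ p ∧ (p : ℕ) < t := by simp only [p]; omega
    have h' := factor_eq hp.1 hp.2
    rw [h] at h'
    obtain ⟨e1, e2⟩ := List.append_inj h' (by
      simp only [factor, p, List.length_drop, List.length_take]; omega)
    obtain ⟨e3, e4⟩ := List.cons.inj e2
    exact ⟨p, hp, e3.symm, e1, e4⟩
  · rintro ⟨p, hp, rfl, rfl, rfl⟩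
    exact factor_eq hp.1 hp.2

end Realize

/-- The relation expressed by `gameFormula`. -/
def GameRel : Quantifier → ℕ → ℕ → List A → List A → Prop
  | .ex, n, r, w, u => GameLE n r w u
  | .all, n, r, w, u => GameLE n r u w

/-- The ends `lo` and `hi` delimit the factor still in play, so the quantifier of `gameFormula`
ranges over its positions and corresponds to one move in `gameLE_succ`. -/
theorem realize_gameFormula (n r : ℕ) : ∀ (Q : Quantifier) (w : List A) {m : ℕ}
    (lo hi : Option (Fin m)) {u : List A} {v : Empty → Fin u.length} {xs : Fin m → Fin u.length},
    (gameFormula Q n r w lo hi).Realize v xs ↔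
      GameRel Q n r w (factor u (startPos xs lo) (stopPos xs hi)) := by
  induction n, r using gameInduction with
  | h0 r =>
    intro Q w m lo hi u v xs
    rw [gameFormula]
    cases Q <;> simp [GameRel, gameLE_zero_left]
  | h1 n =>
    intro Q w m lo hi u v xs
    cases Q <;> cases n <;> rw [gameFormula] <;> simp [GameRel, gameLE_zero_right]
  | h2 n r ih1 ih2 =>
    intro Q w m lo hi u v xs
    cases Q with
    | ex =>
      rw [gameFormula, BoundedFormula.realize_inf, ih1, GameRel, gameLE_succ, realize_listInf]
      refine and_congr Iff.rfl ?_
      simp only [List.forall_mem_map, mem_splits, BoundedFormula.realize_ex,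
        BoundedFormula.realize_inf, realize_between, realize_letterFormula, ih2, GameRel,
        Fin.snoc_last, startPos_castSucc, stopPos_castSucc, startPos_last, stopPos_last,
        factor_eq_append_cons (stopPos_le hi), Prod.forall]
      refine forall₄_congr fun x a x' _ => ⟨?_, ?_⟩
      · rintro ⟨p, h1, h2, h3, h4⟩
        exact ⟨_, _, ⟨p, h1, h2, rfl, rfl⟩, h3, h4⟩
      · rintro ⟨_, _, ⟨p, h1, h2, rfl, rfl⟩, h3, h4⟩
        exact ⟨p, h1, h2, h3, h4⟩
    | all =>
      rw [gameFormula, BoundedFormula.realize_inf, ih1]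
      refine Iff.trans (and_congr Iff.rfl ?_) gameLE_succ.symm
      simp only [BoundedFormula.realize_all, BoundedFormula.realize_imp, realize_between,
        realize_listSup_map, mem_splits,
        BoundedFormula.realize_inf, realize_letterFormula, ih2, GameRel,
        Fin.snoc_last, startPos_castSucc, stopPos_castSucc, startPos_last, stopPos_last,
        factor_eq_append_cons (stopPos_le hi), Prod.exists]
      constructor
      · rintro h _ a _ ⟨p, h1, h2, rfl, rfl⟩
        obtain ⟨x, b, x', e, h3, h4, h5⟩ := h p h1
        obtain rfl := h2.symm.trans h3
        exact ⟨x, x', e, h4, h5⟩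
      · intro h p hp
        obtain ⟨x, x', e, h1, h2⟩ := h _ _ _ ⟨p, hp, rfl, rfl, rfl⟩
        exact ⟨x, _, x', e, rfl, h1, h2⟩

/-- The game preorders have finitely many classes. -/
theorem exists_finite_index [Finite A] (n r : ℕ) : ∃ (T : Type) (_ : Finite T) (f : List A → T),
    ∀ w w', f w = f w' → GameLE n r w w' := by
  induction n, r using gameInduction with
  | h0 r => exact ⟨Unit, inferInstance, fun _ => (), fun _ _ _ => gameLE_zero_left ..⟩
  | h1 n => exact ⟨Unit, inferInstance, fun _ => (), fun _ _ _ => gameLE_zero_right ..⟩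
  | h2 n r ih1 ih2 =>
    obtain ⟨T₁, _, f₁, h1⟩ := ih1
    obtain ⟨T₂, _, f₂, h2⟩ := ih2
    -- The invariant of a word consists of its invariant for the dual relation and of the set of
    -- triples (invariant, letter, invariant) given by its cuts.
    refine ⟨T₁ × Set (T₂ × A × T₂), inferInstance,
      fun w => (f₁ w, {t | ∃ x a x', w = x ++ a :: x' ∧ t = (f₂ x, a, f₂ x')}), fun w w' e => ?_⟩
    obtain ⟨e1, e2⟩ := Prod.mk.inj e
    refine gameLE_succ.2 ⟨h1 _ _ e1.symm, fun x a x' hw => ?_⟩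
    have : (f₂ x, a, f₂ x') ∈ {t | ∃ x a x', w' = x ++ a :: x' ∧ t = (f₂ x, a, f₂ x')} :=
      e2 ▸ ⟨x, a, x', hw, rfl⟩
    obtain ⟨y, b, y', hw', h⟩ := this
    simp only [Prod.mk.injEq] at h
    obtain ⟨h3, rfl, h4⟩ := h
    exact ⟨y, y', hw', h2 _ _ h3, h2 _ _ h4⟩

/-- A language is definable at level `n` if and only if it is closed for one of the game
preorders with `n` alternations. -/
theorem exists_hasLevel_iff [Finite A] (Q : Quantifier) (n : ℕ) (K : Language A) :
    (∃ φ : (wordLang A).Sentence, HasLevel Q n φ ∧ ∀ w : List A, w ∈ K ↔ Satisfies w φ) ↔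
      ∃ r, ∀ w ∈ K, ∀ u, GameRel Q n r w u → u ∈ K := by
  constructor
  · rintro ⟨φ, hφ, hK⟩
    obtain ⟨r, h⟩ := hφ.exists_transfer
    refine ⟨r, fun w hw u hu => ?_⟩
    rw [hK] at hw ⊢
    cases Q with
    | ex => exact h w u [] (.nil hu) _ _ _ _ (fun i => i.elim0) hw
    | all => exact h u w [] (.nil hu) _ _ _ _ (fun i => i.elim0) hw
  · rintro ⟨r, h⟩
    -- Finitely many words of `K` represent all its classes. Closure makes `K` the union of the sets
    -- of words above them (below them for `all`), each defined by a game formula.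
    obtain ⟨T, _, f, hf⟩ := exists_finite_index (A := A) n r
    have hfin : (f '' {w | w ∈ K}).Finite := Set.toFinite _
    choose g hg using fun t : f '' {w | w ∈ K} => t.2
    let reps : List (List A) := hfin.toFinset.attach.toList.map fun t =>
      g ⟨t.1, hfin.mem_toFinset.1 t.2⟩
    have hreps : ∀ w ∈ reps, w ∈ K := by
      intro w hw
      obtain ⟨t, _, rfl⟩ := List.mem_map.1 hw
      exact (hg _).1
    have hreps' : ∀ w ∈ K, ∃ w' ∈ reps, f w' = f w := by
      intro w hw
      have hw' : f w ∈ f '' {w | w ∈ K} := ⟨w, hw, rfl⟩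
      exact ⟨g ⟨f w, hw'⟩, List.mem_map.2 ⟨⟨f w, hfin.mem_toFinset.2 hw'⟩, by simp, rfl⟩, (hg _).2⟩
    refine ⟨listSup (reps.map fun w => gameFormula Q n r w none none), HasLevel.listSup ?_, ?_⟩
    · intro φ hφ
      obtain ⟨w, _, rfl⟩ := List.mem_map.1 hφ
      exact hasLevel_gameFormula ..
    · intro u
      have hu : ∀ xs : Fin 0 → Fin u.length,
          factor u (startPos xs none) (stopPos xs none) = u := fun xs => by
        simp [factor, startPos, stopPos]
      change _ ↔ (listSup _).Realize _ _
      simp only [realize_listSup_map, realize_gameFormula, hu]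
      constructor
      · intro h'
        obtain ⟨w, hw, e⟩ := hreps' u h'
        refine ⟨w, hw, ?_⟩
        cases Q
        exacts [hf _ _ e, hf _ _ e.symm]
      · rintro ⟨w, hw, h'⟩
        exact h w (hreps w hw) u h'

theorem sigmaDefinable_iff [Finite A] (n : ℕ) (K : Language A) :
    SigmaDefinable n K ↔ ∃ r, ∀ w ∈ K, ∀ u, GameLE n r w u → u ∈ K :=
  exists_hasLevel_iff .ex n K

theorem piDefinable_iff [Finite A] (n : ℕ) (K : Language A) :
    PiDefinable n K ↔ ∃ r, ∀ w ∈ K, ∀ u, GameLE n r u w → u ∈ K :=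
  exists_hasLevel_iff .all n K

end Logic

end WordLogic

namespace WordLogic

/-! ### Algebraic characterizations -/

section Algebra

open scoped Pointwise

set_option linter.unusedSectionVars false

variable {A : Type} {M : Type} [Monoid M]

/-- The function `α` is a morphism from the monoid of words. -/
structure IsWordHom (α : List A → M) : Prop where
  map_nil : α [] = 1
  map_append : ∀ x y, α (x ++ y) = α x * α y

/-- The pair `(t, s)` is a `Σ₂`-pair: for every rank there are words of values `t` and `s`, the
first of which is below the second one. -/
def IsPair (α : List A → M) (t s : M) : Prop :=
  ∀ r, ∃ u z, GameLE 2 r u z ∧ α u = t ∧ α z = s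

/-- Each of the finitely many pairs of values that is not a `Σ₂`-pair is excluded at some rank; a
common upper bound serves all of them. -/
theorem exists_rank_isPair [Finite M] (α : List A → M) :
    ∃ r, ∀ u z, GameLE 2 r u z → IsPair α (α u) (α z) := by
  have h : ∀ p : M × M, ∃ r, ∀ u z, GameLE 2 r u z → α u = p.1 → α z = p.2 →
      IsPair α p.1 p.2 := by
    intro p
    by_cases hp : IsPair α p.1 p.2
    · exact ⟨0, fun _ _ _ _ _ => hp⟩
    · simp only [IsPair, not_forall] at hp
      obtain ⟨r, hr⟩ := hp
      exact ⟨r, fun u z h h1 h2 => absurd ⟨u, z, h, h1, h2⟩ hr⟩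
  choose r hr using h
  obtain ⟨R, hR⟩ := (Set.finite_range r).bddAbove
  exact ⟨R, fun u z h => hr (α u, α z) u z (h.mono (hR ⟨_, rfl⟩)) rfl rfl⟩

theorem IsWordHom.wordPow {α : List A → M} (hα : IsWordHom α) (w : List A) (n : ℕ) :
    α (wordPow w n) = α w ^ n := by
  induction n with
  | zero => simp [WordLogic.wordPow, hα.map_nil]
  | succ n ih => rw [WordLogic.wordPow, hα.map_append, ih, pow_succ']

theorem IsWordHom.wordPow_of_idem {α : List A → M} (hα : IsWordHom α) {w : List A}
    (h : α w * α w = α w) {n : ℕ} (hn : 0 < n) : α (WordLogic.wordPow w n) = α w := by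
  obtain ⟨n, rfl⟩ := Nat.exists_eq_succ_of_ne_zero hn.ne'
  rw [hα.wordPow, IsIdempotentElem.pow_succ_eq _ h]

/-- If words are covered with compatible values for the letters, then all words are covered with
bounded complexity. -/
theorem exists_bound_of_isCover {N : Type} [Monoid N] [Finite N]
    {C : ℕ → FreeMonoid A → N → Prop} {φ : N → N} {r : ℕ} (hC : IsCover C φ r) {k : ℕ}
    (h1 : C k 1 1) (ha : ∀ a : A, ∃ v, C k (FreeMonoid.of a) v) :
    ∃ K, ∀ w : List A, ∃ v, C K (FreeMonoid.ofList w) v := by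
  choose v hv using ha
  obtain ⟨K, hK⟩ := hC.exists_bound h1 k
  refine ⟨K, fun w => ?_⟩
  obtain ⟨t, ht⟩ := hK (w.map fun a => (FreeMonoid.of a, v a)) (by simpa using fun a _ => hv a)
  have : wordProd (w.map fun a => (FreeMonoid.of a, v a)) = FreeMonoid.ofList w := by
    clear ht
    induction w with
    | nil => rfl
    | cons a w ih => rw [List.map_cons, wordProd_cons, ih, FreeMonoid.ofList_cons]
  exact ⟨t, this ▸ ht⟩

/-- Decidable characterization of `Σ₃(<)` in terms of `Σ₂`-pairs. -/
theorem sigma_three_iff [Finite M] {α : List A → M} (hα : IsWordHom α)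
    (hs : Function.Surjective α) (P : Set M) :
    (∃ r, ∀ w, α w ∈ P → ∀ u, GameLE 3 r w u → α u ∈ P) ↔
      ∀ t e, e * e = e → IsPair α t e → ∀ p q, p * e * q ∈ P → p * e * t * e * q ∈ P := by
  constructor
  · rintro ⟨r, h⟩ t e he hp p q hP
    obtain ⟨u, z, huz, rfl, rfl⟩ := hp r
    obtain ⟨x, rfl⟩ := hs p
    obtain ⟨y, rfl⟩ := hs q
    -- Powers of `z` keep the idempotent value, and `u` can be inserted between two large ones.
    have hpow := hα.wordPow_of_idem he (n := 2 ^ r) (by positivity)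
    have := h (x ++ wordPow z (2 ^ r) ++ y) (by simpa only [hα.map_append, hpow] using hP)
      (x ++ (wordPow z (2 ^ r) ++ u ++ wordPow z (2 ^ r)) ++ y)
      (((GameLE.refl ..).append (gameLE_insert r huz _ _ _ (Nat.sub_le _ _) (Nat.sub_le _ _)
        (Nat.sub_le _ _))).append (GameLE.refl ..))
    simpa only [hα.map_append, hpow, mul_assoc] using this
  · intro h
    obtain ⟨r₀, hr₀⟩ := exists_rank_isPair α
    -- Covered words are those that may be replaced, inside any context, by words above them at rank
    -- `k` without leaving `P`. Loops keep their value, so `φ` is the identity.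
    let C : ℕ → FreeMonoid A → M → Prop := fun k w v => v = α w.toList ∧
      ∀ u, GameLE 3 k w.toList u → ∀ p q, p * v * q ∈ P → p * α u * q ∈ P
    have hC : IsCover C id r₀ := by
      refine ⟨fun hk h => ⟨h.1, fun u hu => h.2 u (hu.mono hk)⟩, ?_, ?_⟩
      · rintro k w w' v v' ⟨rfl, h1⟩ ⟨rfl, h2⟩
        refine ⟨by rw [FreeMonoid.toList_mul, hα.map_append], fun u hu p q hP => ?_⟩
        rw [FreeMonoid.toList_mul] at hu
        obtain ⟨y, y', rfl, hy, hy'⟩ := hu.split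
        have e1 := h1 y hy p (α w'.toList * q) (by simpa only [mul_assoc] using hP)
        have e2 := h2 y' hy' (p * α y) q (by simpa only [mul_assoc] using e1)
        simpa only [hα.map_append, mul_assoc] using e2
      · rintro k k' w z w' a F b hk hF haF hFb ⟨rfl, h1⟩ ⟨rfl, -⟩ ⟨rfl, h2⟩
        refine ⟨by simp [FreeMonoid.toList_mul, hα.map_append, mul_assoc], fun u hu p q hP => ?_⟩
        rw [FreeMonoid.toList_mul, FreeMonoid.toList_mul] at hu
        obtain ⟨y, y', rfl, hy, hy'⟩ := hu.split
        obtain ⟨y, t, rfl, hy, ht⟩ := hy.split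
        -- The middle factor enters only through a `Σ₂`-pair, so the complexity of `z` is
        -- irrelevant; `hFb` and `haF` then remove the idempotents around `α t`.
        have e0 := h (α t) _ hF (hr₀ _ _ (ht.dual.mono hk)) (p * α w.toList) (α w'.toList * q)
          (by simpa only [mul_assoc, id] using hP)
        have e0' : p * α w.toList * (α t * (α w'.toList * q)) ∈ P := by
          rw [← hFb]
          nth_rewrite 1 [← haF]
          simpa only [mul_assoc] using e0
        have e1 := h1 y hy p (α t * (α w'.toList * q)) e0'
        have e2 := h2 y' (hy'.of_succ) (p * α y * α t) q (by simpa only [mul_assoc] using e1)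
        simpa only [hα.map_append, mul_assoc] using e2
    -- At rank 2 only the empty word and the letter itself lie above the empty word and a letter.
    obtain ⟨K, hK⟩ := exists_bound_of_isCover hC (k := 2)
      ⟨hα.map_nil.symm, fun u hu p q hP => by
        rw [GameLE.eq_nil (u := u) hu, hα.map_nil]; exact hP⟩
      (fun a => ⟨α [a], rfl, fun u hu p q hP => by
        rw [GameLE.eq_singleton (u := u) hu]; exact hP⟩)
    refine ⟨K, fun w hw u hu => ?_⟩
    obtain ⟨v, rfl, hv⟩ := hK w
    simpa using hv u hu 1 1 (by simpa using hw)

/-- The values of the words that have the same letters as some word of value `e`. -/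
def sameLetters (α : List A → M) (e : M) : Set M :=
  {x | ∃ w z, α z = e ∧ α w = x ∧ ∀ a, a ∈ w ↔ a ∈ z}

/-- The set `D` is closed under the operations generating the `Σ₂`-pairs. -/
structure IsSaturated (α : List A → M) (D : Set (M × Set M)) : Prop where
  one : (1, {1}) ∈ D
  letter : ∀ a, (α [a], {α [a]}) ∈ D
  mul : ∀ x ∈ D, ∀ y ∈ D, (x.1 * y.1, x.2 * y.2) ∈ D
  loop : ∀ x ∈ D, x.1 * x.1 = x.1 → x.2 * x.2 = x.2 →
    (x.1, x.2 * sameLetters α x.1 * x.2) ∈ D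

/-- Completeness of saturation, by bounded covers with `D` itself as the finite monoid: an element
covers a word if its set contains the values of all words above that word at rank `k`. In a loop the
middle factor is replaced by a word with the same letters, which `sameLetters` accounts for. -/
theorem IsSaturated.exists_of_isPair [Finite M] {α : List A → M} (hα : IsWordHom α)
    {D : Set (M × Set M)} (hD : IsSaturated α D) {t s : M} (h : IsPair α t s) :
    ∃ x ∈ D, x.1 = t ∧ s ∈ x.2 := by
  classical
  let N : Submonoid (M × Set M) :=
    { carrier := D
      one_mem' := hD.one
      mul_mem' := fun ha hb => hD.mul _ ha _ hb }
  let C : ℕ → FreeMonoid A → N → Prop := fun k w v => v.1.1 = α w.toList ∧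
    ∀ u, GameLE 2 k w.toList u → α u ∈ v.1.2
  -- Only idempotents matter, as `IsCover.loop` assumes `F * F = F`; the default value is never
  -- used.
  let φ : N → N := fun F => if hF : F * F = F then
    ⟨(F.1.1, F.1.2 * sameLetters α F.1.1 * F.1.2), hD.loop F.1 F.2
      (congrArg (fun x : N => x.1.1) hF) (congrArg (fun x : N => x.1.2) hF)⟩ else F
  have hC : IsCover C φ 1 := by
    refine ⟨fun hk h => ⟨h.1, fun u hu => h.2 u (hu.mono hk)⟩, ?_, ?_⟩
    · rintro k w w' v v' ⟨h1, h1'⟩ ⟨h2, h2'⟩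
      refine ⟨?_, fun u hu => ?_⟩
      · rw [FreeMonoid.toList_mul, hα.map_append, ← h1, ← h2]; rfl
      · rw [FreeMonoid.toList_mul] at hu
        obtain ⟨y, y', rfl, hy, hy'⟩ := hu.split
        rw [hα.map_append]
        exact Set.mul_mem_mul (h1' y hy) (h2' y' hy')
    · rintro k k' w z w' a F b hk hF haF hFb ⟨h1, h1'⟩ ⟨hz, -⟩ ⟨h2, h2'⟩
      have hφ : φ F = ⟨(F.1.1, F.1.2 * sameLetters α F.1.1 * F.1.2), hD.loop F.1 F.2
        (congrArg (fun x : N => x.1.1) hF) (congrArg (fun x : N => x.1.2) hF)⟩ := dif_pos hF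
      have haF' : a.1.2 * F.1.2 = a.1.2 := congrArg (fun x : N => x.1.2) haF
      have hFb' : F.1.2 * b.1.2 = b.1.2 := congrArg (fun x : N => x.1.2) hFb
      refine ⟨?_, fun u hu => ?_⟩
      · rw [hφ, FreeMonoid.toList_mul, FreeMonoid.toList_mul, hα.map_append, hα.map_append,
          ← h1, ← h2, ← hz]
        rfl
      · rw [FreeMonoid.toList_mul, FreeMonoid.toList_mul] at hu
        obtain ⟨y, y', rfl, hy, hy'⟩ := hu.split
        obtain ⟨y, t, rfl, hy, ht⟩ := hy.split
        -- Level 2 preserves the set of letters as soon as the rank is positive; hence the threshold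
        -- 1 of this cover.
        obtain ⟨k, rfl⟩ := Nat.exists_eq_add_of_le' hk
        have ht' : α t ∈ sameLetters α F.1.1 := ⟨t, _, hz.symm, rfl, fun a => ht.mem_iff.symm⟩
        have hv : (a * φ F * b : N).1.2 = a.1.2 * sameLetters α F.1.1 * b.1.2 := by
          rw [hφ]
          change a.1.2 * (F.1.2 * sameLetters α F.1.1 * F.1.2) * b.1.2 = _
          calc _ = (a.1.2 * F.1.2) * sameLetters α F.1.1 * (F.1.2 * b.1.2) := by
                simp only [mul_assoc]
            _ = _ := by rw [haF', hFb']
        rw [hv, hα.map_append, hα.map_append]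
        exact Set.mul_mem_mul (Set.mul_mem_mul (h1' y hy) ht') (h2' y' hy'.of_succ)
  obtain ⟨K, hK⟩ := exists_bound_of_isCover hC (k := 2)
    ⟨hα.map_nil.symm, fun u hu => by
      rw [GameLE.eq_nil (u := u) hu, hα.map_nil]; exact Set.mem_singleton _⟩
    (fun a => ⟨⟨(α [a], {α [a]}), hD.letter a⟩, rfl, fun u hu => by
      rw [GameLE.eq_singleton (u := u) hu]; exact Set.mem_singleton _⟩)
  obtain ⟨u, z, huz, rfl, rfl⟩ := h K
  obtain ⟨v, h1, h2⟩ := hK u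
  exact ⟨v.1, v.2, h1, h2 z huz⟩

/-- For every rank, there is a word of value `x.1` that is below words of all values in `x.2`. -/
def IsSound (α : List A → M) (x : M × Set M) : Prop :=
  ∀ r, ∃ w, α w = x.1 ∧ ∀ s ∈ x.2, ∃ u, GameLE 2 r w u ∧ α u = s

theorem IsSound.isPair {α : List A → M} {x : M × Set M} (h : IsSound α x) {s : M}
    (hs : s ∈ x.2) : IsPair α x.1 s := by
  intro r
  obtain ⟨w, hw, h⟩ := h r
  obtain ⟨u, hu, hu'⟩ := h s hs
  exact ⟨w, u, hu, hw, hu'⟩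

theorem isSound_word (α : List A → M) (w : List A) : IsSound α (α w, {α w}) :=
  fun _ => ⟨w, rfl, fun _ hs => ⟨w, GameLE.refl .., hs.symm⟩⟩

theorem IsSound.mul {α : List A → M} (hα : IsWordHom α) {x y : M × Set M} (hx : IsSound α x)
    (hy : IsSound α y) : IsSound α (x.1 * y.1, x.2 * y.2) := by
  intro r
  obtain ⟨w, hw, h⟩ := hx r
  obtain ⟨w', hw', h'⟩ := hy r
  refine ⟨w ++ w', by rw [hα.map_append, hw, hw'], ?_⟩
  rintro _ ⟨s, hs, s', hs', rfl⟩
  obtain ⟨u, hu, rfl⟩ := h s hs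
  obtain ⟨u', hu', rfl⟩ := h' s' hs'
  exact ⟨u ++ u', hu.append hu', hα.map_append ..⟩

/-- Powers are taken twice. At level 1 the inner power is above every word over its letters;
therefore at level 2 such a word can be inserted into the outer power. By `hl` the words counted in
`sameLetters` use exactly the letters of `w`. The two sides grow to the values `s` and `s'`, and
both are powers of the same word: this is why soundness asks for one word below all values of the
set. -/
theorem IsSound.loop {α : List A → M} (hα : IsWordHom α)
    (hl : ∀ w w', α w = α w' → ∀ a, a ∈ w ↔ a ∈ w') {x : M × Set M} (hx : IsSound α x)
    (h1 : x.1 * x.1 = x.1) (h2 : x.2 * x.2 = x.2) :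
    IsSound α (x.1, x.2 * sameLetters α x.1 * x.2) := by
  intro r
  obtain ⟨w, hw, h⟩ := hx r
  -- As the set is idempotent, each of its values is a product of `n + 1` of its values.
  have hpow : ∀ w, (∀ s ∈ x.2, ∃ u, GameLE 2 r w u ∧ α u = s) → ∀ n, ∀ s ∈ x.2,
      ∃ u, GameLE 2 r (wordPow w (n + 1)) u ∧ α u = s := by
    intro w h n
    induction n with
    | zero => simpa [wordPow] using h
    | succ n ih =>
      intro s hs
      rw [← h2] at hs
      obtain ⟨s, hs, s', hs', rfl⟩ := hs
      obtain ⟨u, hu, rfl⟩ := h s hs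
      obtain ⟨u', hu', rfl⟩ := ih s' hs'
      exact ⟨u ++ u', hu.append hu', hα.map_append ..⟩
  have hwi : α w * α w = α w := by rw [hw, h1]
  have hW : α (wordPow w (2 ^ r - 1 + 1)) = α w := hα.wordPow_of_idem hwi (by omega)
  refine ⟨wordPow (wordPow w (2 ^ r - 1 + 1)) (2 ^ r - 1 + 1), ?_, ?_⟩
  · rw [hα.wordPow_of_idem (by rw [hW, hwi]) (by omega), hW, hw]
  · rintro _ ⟨_, ⟨s, hs, _, ⟨t, z, hz, rfl, htz⟩, rfl⟩, s', hs', rfl⟩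
    obtain ⟨u, hu, rfl⟩ := hpow _ (hpow w h (2 ^ r - 1)) (2 ^ r - 1) s hs
    obtain ⟨u', hu', rfl⟩ := hpow _ (hpow w h (2 ^ r - 1)) (2 ^ r - 1) s' hs'
    refine ⟨u ++ t ++ u', ?_, by simp only [hα.map_append]⟩
    refine (gameLE_insert (n := 1) r (u := t) ?_ _ (2 ^ r - 1 + 1) (2 ^ r - 1 + 1) (by omega)
      (by omega) (by omega)).trans ((hu.append (GameLE.refl ..)).append hu')
    exact gameLE_one_wordPow r (fun a ha => (hl z w (hz.trans hw.symm) a).1 ((htz a).1 ha)) _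
      (by omega)

end Algebra

end WordLogic

namespace WordLogic

/-! ### Saturation of automata -/

section Saturation

open scoped Pointwise

namespace AutomatonCode

variable (c : AutomatonCode)

/-- Two words are congruent if they have the same letters and the same action on the states. -/
def con : Con (FreeMonoid (Fin c.letters)) where
  r w w' := (∀ S, c.toNFA.evalFrom S w.toList = c.toNFA.evalFrom S w'.toList) ∧
    ∀ a, a ∈ w.toList ↔ a ∈ w'.toList
  iseqv :=
    { refl := fun _ => ⟨fun _ => rfl, fun _ => Iff.rfl⟩
      symm := fun h => ⟨fun S => (h.1 S).symm, fun a => (h.2 a).symm⟩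
      trans := fun h h' => ⟨fun S => (h.1 S).trans (h'.1 S), fun a => (h.2 a).trans (h'.2 a)⟩ }
  mul' := by
    intro w x y z h h'
    refine ⟨fun S => ?_, fun a => ?_⟩
    · rw [FreeMonoid.toList_mul, FreeMonoid.toList_mul, NFA.evalFrom_append, NFA.evalFrom_append,
        h.1, h'.1]
    · rw [FreeMonoid.toList_mul, FreeMonoid.toList_mul, List.mem_append, List.mem_append, h.2, h'.2]

/-- The transition monoid, extended by the sets of letters. -/
abbrev TransMonoid : Type := c.con.Quotient

instance : Finite c.TransMonoid := by
  let f : c.TransMonoid → (Set (Fin c.states) → Set (Fin c.states)) × Set (Fin c.letters) :=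
    fun m => Con.liftOn m (fun w => (fun S => c.toNFA.evalFrom S w.toList, {a | a ∈ w.toList}))
      fun w w' h => Prod.ext (funext h.1) (Set.ext h.2)
  refine Finite.of_injective f fun x y => ?_
  induction x using Con.induction_on with | _ x
  induction y using Con.induction_on with | _ y
  intro h
  obtain ⟨h1, h2⟩ := Prod.mk.inj h
  exact (Con.eq c.con).2 ⟨fun S => congrFun h1 S, fun a => Set.ext_iff.1 h2 a⟩

/-- The value of a word in the transition monoid. -/
def transHom (w : List (Fin c.letters)) : c.TransMonoid := (FreeMonoid.ofList w : FreeMonoid _)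

theorem isWordHom_transHom : IsWordHom c.transHom where
  map_nil := rfl
  map_append _ _ := rfl

theorem transHom_surjective : Function.Surjective c.transHom := by
  intro m
  induction m using Con.induction_on with | _ w
  exact ⟨w.toList, rfl⟩

theorem transHom_eq_iff {w w' : List (Fin c.letters)} : c.transHom w = c.transHom w' ↔
    (∀ S, c.toNFA.evalFrom S w = c.toNFA.evalFrom S w') ∧ ∀ a, a ∈ w ↔ a ∈ w' :=
  Con.eq c.con

/-- Read a list of numbers as a word, ignoring the numbers that are not letters. -/
def decodeWord (w : List ℕ) : List (Fin c.letters) :=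
  w.filterMap fun a => if h : a < c.letters then some ⟨a, h⟩ else none

theorem decodeWord_append (x y : List ℕ) :
    c.decodeWord (x ++ y) = c.decodeWord x ++ c.decodeWord y := List.filterMap_append

theorem decodeWord_map (w : List (Fin c.letters)) : c.decodeWord (w.map Fin.val) = w := by
  simp [decodeWord, List.filterMap_map]

theorem mem_decodeWord {w : List ℕ} {a : Fin c.letters} : a ∈ c.decodeWord w ↔ (a : ℕ) ∈ w := by
  simp only [decodeWord, List.mem_filterMap]
  constructor
  · rintro ⟨b, hb, h⟩
    split at h
    · cases h; exact hb
    · cases h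
  · exact fun h => ⟨a, h, by simp⟩

/-- The value of a list of numbers in the transition monoid. -/
def value (w : List ℕ) : c.TransMonoid := c.transHom (c.decodeWord w)

theorem value_nil : c.value [] = 1 := rfl

theorem value_append (x y : List ℕ) : c.value (x ++ y) = c.value x * c.value y := by
  rw [value, decodeWord_append, c.isWordHom_transHom.map_append]; rfl

theorem value_map (w : List (Fin c.letters)) : c.value (w.map Fin.val) = c.transHom w := by
  rw [value, decodeWord_map]

/-- The states reached from the states in `Q` by one letter. -/
def stepList (Q : List ℕ) (a : ℕ) : List ℕ :=
  if a < c.1 then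
    (List.range c.2.1).filter fun q' => ∃ q ∈ List.range c.2.1, q ∈ Q ∧ (q, a, q') ∈ c.2.2.1
  else Q

/-- The states reached from the states in `Q` by a word. -/
def reach (Q w : List ℕ) : List ℕ := w.foldl c.stepList Q

theorem mem_reach {w Q : List ℕ} {q : Fin c.states} : (q : ℕ) ∈ c.reach Q w ↔
    q ∈ c.toNFA.evalFrom {p | (p : ℕ) ∈ Q} (c.decodeWord w) := by
  induction w generalizing Q with
  | nil => simp [reach, decodeWord]
  | cons a w ih =>
    have : c.reach Q (a :: w) = c.reach (c.stepList Q a) w := rfl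
    rw [this, ih]
    by_cases ha : a < c.letters
    · have hd : c.decodeWord (a :: w) = ⟨a, ha⟩ :: c.decodeWord w := by simp [decodeWord, ha]
      rw [hd, NFA.evalFrom_cons]
      have : {p : Fin c.states | (p : ℕ) ∈ c.stepList Q a} =
          c.toNFA.stepSet {p | (p : ℕ) ∈ Q} ⟨a, ha⟩ := by
        ext p
        rw [NFA.mem_stepSet]
        simp only [stepList, if_pos ha, List.mem_filter, List.mem_range, decide_eq_true_eq,
          Set.mem_ofPred_eq, toNFA]
        constructor
        · rintro ⟨-, q, hq, h1, h2⟩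
          exact ⟨⟨q, hq⟩, h1, h2⟩
        · rintro ⟨q, h1, h2⟩
          exact ⟨p.2, q, q.2, h1, h2⟩
      rw [this]
    · have hd : c.decodeWord (a :: w) = c.decodeWord w := by simp [decodeWord, ha]
      rw [hd, stepList, if_neg ha]

/-- The letters of a word, in increasing order. -/
def letterSet (w : List ℕ) : List ℕ := (List.range c.1).filter fun a => a ∈ w

/-- A normal form for the value of a word. -/
def signature (w : List ℕ) : List (List ℕ) × List ℕ :=
  ((List.range c.2.1).map fun p => (List.range c.2.1).filter fun q => q ∈ c.reach [p] w,
    c.letterSet w)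

theorem filter_eq_filter_iff {l : List ℕ} {p q : ℕ → Bool} :
    l.filter p = l.filter q ↔ ∀ x ∈ l, (p x ↔ q x) := by
  constructor
  · intro h x hx
    have : x ∈ l.filter p ↔ x ∈ l.filter q := by rw [h]
    simpa [List.mem_filter, hx] using this
  · intro h
    exact List.filter_congr fun x hx => Bool.eq_iff_iff.2 (h x hx)

theorem letterSet_eq_iff {w w' : List ℕ} : c.letterSet w = c.letterSet w' ↔
    ∀ a, a ∈ c.decodeWord w ↔ a ∈ c.decodeWord w' := by
  simp only [letterSet, filter_eq_filter_iff, List.mem_range, decide_eq_true_eq, mem_decodeWord]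
  exact ⟨fun h a => h a a.2, fun h a ha => h ⟨a, ha⟩⟩

/-- This makes equality in the transition monoid a computable test on lists. Single starting states
suffice because `evalFrom` commutes with unions. -/
theorem signature_eq_iff {w w' : List ℕ} :
    c.signature w = c.signature w' ↔ c.value w = c.value w' := by
  rw [value, value, transHom_eq_iff, signature, signature, Prod.mk.injEq, letterSet_eq_iff]
  refine and_congr ?_ Iff.rfl
  simp only [List.map_inj_left, filter_eq_filter_iff, List.mem_range, decide_eq_true_eq]
  have single : ∀ p : Fin c.states, {q : Fin c.states | (q : ℕ) ∈ [(p : ℕ)]} = {p} := by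
    intro p; ext q; simp [Fin.ext_iff]
  constructor
  · intro h S
    ext q
    rw [NFA.mem_evalFrom_iff_exists, NFA.mem_evalFrom_iff_exists]
    refine exists_congr fun p => and_congr Iff.rfl ?_
    have := h p p.2 q q.2
    rwa [mem_reach, mem_reach, single] at this
  · intro h p hp q hq
    have := c.mem_reach (w := w) (Q := [p]) (q := ⟨q, hq⟩)
    rw [h, ← mem_reach] at this
    exact this

/-- The automaton accepts the word. -/
def Accepts (w : List ℕ) : Prop :=
  ∃ q ∈ List.range c.2.1, q ∈ c.reach c.2.2.2.1 w ∧ q ∈ c.2.2.2.2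

theorem accepts_iff {w : List ℕ} : c.Accepts w ↔ c.decodeWord w ∈ c.language := by
  constructor
  · rintro ⟨q, hq, h1, h2⟩
    rw [List.mem_range] at hq
    exact ⟨⟨q, hq⟩, h2, (c.mem_reach (q := ⟨q, hq⟩)).1 h1⟩
  · rintro ⟨q, h1, h2⟩
    exact ⟨q, List.mem_range.2 q.2, c.mem_reach.2 h2, h1⟩

theorem mem_language_congr {w w' : List (Fin c.letters)} (h : c.transHom w = c.transHom w') :
    w ∈ c.language ↔ w' ∈ c.language := by
  have := (c.transHom_eq_iff.1 h).1 c.toNFA.start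
  exact exists_congr fun q => and_congr Iff.rfl (by
    change q ∈ c.toNFA.evalFrom c.toNFA.start w ↔ q ∈ c.toNFA.evalFrom c.toNFA.start w'
    rw [this])

/-- The values of the accepted words. -/
def acceptSet : Set c.TransMonoid := {m | ∃ w ∈ c.language, c.transHom w = m}

theorem transHom_mem_acceptSet {w : List (Fin c.letters)} :
    c.transHom w ∈ c.acceptSet ↔ w ∈ c.language :=
  ⟨fun ⟨_, hw, h⟩ => (c.mem_language_congr h).1 hw, fun h => ⟨w, h, rfl⟩⟩

theorem value_mem_acceptSet {w : List ℕ} : c.value w ∈ c.acceptSet ↔ c.Accepts w := by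
  rw [value, transHom_mem_acceptSet, accepts_iff]

/-- Extend all the words in a list by all letters. -/
def nextWords (W : List (List ℕ)) : List (List ℕ) :=
  W ++ W.flatMap fun w => (List.range c.1).map fun a => w ++ [a]

/-- The list contains words for all values. -/
def CompleteWords (W : List (List ℕ)) : Prop :=
  ∀ w ∈ c.nextWords W, ∃ w' ∈ W, c.signature w = c.signature w'

/-- The concatenations of words from two lists. -/
def products (X Y : List (List ℕ)) : List (List ℕ) :=
  X.flatMap fun t => Y.map fun t' => t ++ t'

/-- The words in the first list have values of words in the second list. -/
def ValuesSubset (X Y : List (List ℕ)) : Prop :=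
  ∀ t ∈ X, ∃ t' ∈ Y, c.signature t = c.signature t'

/-- The two pairs, of a word and a list of words, have the same values. -/
def SameValues (x y : List ℕ × List (List ℕ)) : Prop :=
  c.signature x.1 = c.signature y.1 ∧ c.ValuesSubset x.2 y.2 ∧ c.ValuesSubset y.2 x.2

/-- The product of two pairs. -/
def mulPair (x y : List ℕ × List (List ℕ)) : List ℕ × List (List ℕ) :=
  (x.1 ++ y.1, products x.2 y.2)

/-- The result of the idempotent operation for a pair. -/
def loopPair (W : List (List ℕ)) (x : List ℕ × List (List ℕ)) : List ℕ × List (List ℕ) :=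
  (x.1, products (products x.2 (W.filter fun w => c.letterSet x.1 = c.letterSet w)) x.2)

open Classical in
/-- One round of the saturation procedure. -/
noncomputable def nextPairs (W : List (List ℕ)) (D : List (List ℕ × List (List ℕ))) :
    List (List ℕ × List (List ℕ)) :=
  D ++ (([], [[]]) :: ((List.range c.1).map (fun a => ([a], [[a]])) ++
    (D.flatMap (fun x => D.map fun y => mulPair x y) ++
      (D.filter fun x => c.SameValues (mulPair x x) x).map fun x => c.loopPair W x)))

/-- The list contains all pairs obtained by saturation, up to values. -/
def CompletePairs (W : List (List ℕ)) (D : List (List ℕ × List (List ℕ))) : Prop :=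
  ∀ x ∈ c.nextPairs W D, ∃ y ∈ D, c.SameValues x y

/-- The value of a pair. -/
def pairValue (x : List ℕ × List (List ℕ)) : c.TransMonoid × Set c.TransMonoid :=
  (c.value x.1, c.value '' {t | t ∈ x.2})

theorem image_value_products (X Y : List (List ℕ)) : c.value '' {t | t ∈ products X Y} =
    c.value '' {t | t ∈ X} * c.value '' {t | t ∈ Y} := by
  ext m
  simp only [products, Set.mem_mul, Set.mem_image, Set.mem_ofPred_eq, List.mem_flatMap,
    List.mem_map]
  constructor
  · rintro ⟨_, ⟨t, ht, t', ht', rfl⟩, rfl⟩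
    exact ⟨_, ⟨t, ht, rfl⟩, _, ⟨t', ht', rfl⟩, (c.value_append ..).symm⟩
  · rintro ⟨_, ⟨t, ht, rfl⟩, _, ⟨t', ht', rfl⟩, rfl⟩
    exact ⟨_, ⟨t, ht, t', ht', rfl⟩, c.value_append ..⟩

theorem valuesSubset_iff {X Y : List (List ℕ)} :
    c.ValuesSubset X Y ↔ c.value '' {t | t ∈ X} ⊆ c.value '' {t | t ∈ Y} := by
  rw [Set.image_subset_iff]
  refine forall₂_congr fun t _ => ?_
  simp only [signature_eq_iff, Set.mem_preimage, Set.mem_image, Set.mem_ofPred_eq, eq_comm]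

theorem sameValues_iff {x y : List ℕ × List (List ℕ)} :
    c.SameValues x y ↔ c.pairValue x = c.pairValue y := by
  rw [SameValues, valuesSubset_iff, valuesSubset_iff, ← Set.Subset.antisymm_iff, signature_eq_iff,
    pairValue, pairValue, Prod.mk.injEq]

theorem pairValue_mulPair (x y : List ℕ × List (List ℕ)) : c.pairValue (mulPair x y) =
    ((c.pairValue x).1 * (c.pairValue y).1, (c.pairValue x).2 * (c.pairValue y).2) := by
  simp only [pairValue, mulPair, value_append, image_value_products]

theorem sameValues_mulPair_self_iff {x : List ℕ × List (List ℕ)} :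
    c.SameValues (mulPair x x) x ↔ (c.pairValue x).1 * (c.pairValue x).1 = (c.pairValue x).1 ∧
      (c.pairValue x).2 * (c.pairValue x).2 = (c.pairValue x).2 := by
  rw [sameValues_iff, pairValue_mulPair, Prod.ext_iff]

theorem transHom_letters (w w' : List (Fin c.letters)) (h : c.transHom w = c.transHom w') :
    ∀ a, a ∈ w ↔ a ∈ w' := (c.transHom_eq_iff.1 h).2

/-- The list of words contains words of all values. -/
def Covers (W : List (List ℕ)) : Prop := ∀ m, ∃ w ∈ W, c.value w = m

/-- The letters of a word depend only on its value, so filtering representatives of all values by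
their letters gives all of `sameLetters`. -/
theorem pairValue_loopPair {W : List (List ℕ)} (hW : c.Covers W)
    (x : List ℕ × List (List ℕ)) : c.pairValue (c.loopPair W x) = ((c.pairValue x).1,
      (c.pairValue x).2 * sameLetters c.transHom (c.pairValue x).1 * (c.pairValue x).2) := by
  simp only [pairValue, loopPair, image_value_products]
  congr 3
  ext m
  simp only [Set.mem_image, Set.mem_ofPred_eq, List.mem_filter, decide_eq_true_eq,
    letterSet_eq_iff, sameLetters]
  constructor
  · rintro ⟨w, ⟨_, h⟩, rfl⟩
    exact ⟨_, _, rfl, rfl, fun a => (h a).symm⟩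
  · rintro ⟨w, z, hz, rfl, h⟩
    obtain ⟨w', hw', e⟩ := hW (c.transHom w)
    refine ⟨w', ⟨hw', fun a => ?_⟩, e⟩
    rw [c.transHom_letters _ _ e a, h a, c.transHom_letters _ _ hz a]

/-- Induction on the length of a word: a representative of a prefix, extended by a letter, has the
value of another word of the list. -/
theorem CompleteWords.covers {W : List (List ℕ)} (h0 : [] ∈ W) (h : c.CompleteWords W) :
    c.Covers W := by
  intro m
  obtain ⟨w, rfl⟩ := c.transHom_surjective m
  induction w using List.reverseRecOn with
  | nil => exact ⟨[], h0, rfl⟩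
  | append_singleton w a ih =>
    obtain ⟨w', hw', e⟩ := ih
    obtain ⟨w'', hw'', e'⟩ := h (w' ++ [(a : ℕ)]) (List.mem_append_right _
      (List.mem_flatMap.2 ⟨w', hw', List.mem_map.2 ⟨a, List.mem_range.2 a.2, rfl⟩⟩))
    refine ⟨w'', hw'', ?_⟩
    rw [← c.signature_eq_iff.1 e', value_append, e, c.isWordHom_transHom.map_append,
      ← c.value_map [a]]
    rfl

theorem mem_nextPairs {W : List (List ℕ)} {D : List (List ℕ × List (List ℕ))}
    {x : List ℕ × List (List ℕ)} : x ∈ c.nextPairs W D ↔ x ∈ D ∨ x = ([], [[]]) ∨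
      (∃ a < c.letters, x = ([a], [[a]])) ∨ (∃ y ∈ D, ∃ z ∈ D, x = mulPair y z) ∨
      ∃ y ∈ D, c.SameValues (mulPair y y) y ∧ x = c.loopPair W y := by
  simp only [nextPairs, List.mem_append, List.mem_cons, List.mem_map, List.mem_range,
    List.mem_flatMap, List.mem_filter, decide_eq_true_eq, and_assoc, eq_comm (b := x)]

theorem pairValue_singleton (a : Fin c.letters) :
    c.pairValue ([(a : ℕ)], [[(a : ℕ)]]) = (c.transHom [a], {c.transHom [a]}) := by
  have : c.value [(a : ℕ)] = c.transHom [a] := c.value_map [a]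
  simp [pairValue, this]

theorem pairValue_nil : c.pairValue ([], [[]]) = (1, {1}) := by
  simp [pairValue, value_nil]

theorem CompletePairs.isSaturated {W : List (List ℕ)} {D : List (List ℕ × List (List ℕ))}
    (hW : c.Covers W) (h : c.CompletePairs W D) :
    IsSaturated c.transHom (c.pairValue '' {x | x ∈ D}) := by
  have h' : ∀ x ∈ c.nextPairs W D, c.pairValue x ∈ c.pairValue '' {x | x ∈ D} := by
    intro x hx
    obtain ⟨y, hy, e⟩ := h x hx
    exact ⟨y, hy, (c.sameValues_iff.1 e).symm⟩
  simp only [mem_nextPairs] at h'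
  refine ⟨?_, fun a => ?_, ?_, ?_⟩
  · rw [← pairValue_nil]
    exact h' _ (by simp)
  · rw [← pairValue_singleton]
    exact h' _ (.inr (.inr (.inl ⟨a, a.2, rfl⟩)))
  · rintro _ ⟨x, hx, rfl⟩ _ ⟨y, hy, rfl⟩
    rw [← pairValue_mulPair]
    exact h' _ (.inr (.inr (.inr (.inl ⟨x, hx, y, hy, rfl⟩))))
  · rintro _ ⟨x, hx, rfl⟩ h1 h2
    rw [← c.pairValue_loopPair hW]
    exact h' _ (.inr (.inr (.inr (.inr ⟨x, hx, c.sameValues_mulPair_self_iff.2 ⟨h1, h2⟩, rfl⟩))))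

theorem isSound_nextPairs {W : List (List ℕ)} {D : List (List ℕ × List (List ℕ))}
    (hW : c.Covers W) (h : ∀ x ∈ D, IsSound c.transHom (c.pairValue x)) :
    ∀ x ∈ c.nextPairs W D, IsSound c.transHom (c.pairValue x) := by
  intro x hx
  rw [mem_nextPairs] at hx
  rcases hx with hx | rfl | ⟨a, ha, rfl⟩ | ⟨y, hy, z, hz, rfl⟩ | ⟨y, hy, hyy, rfl⟩
  · exact h x hx
  · rw [pairValue_nil]
    exact isSound_word c.transHom []
  · rw [c.pairValue_singleton ⟨a, ha⟩]
    exact isSound_word c.transHom [⟨a, ha⟩]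
  · rw [pairValue_mulPair]
    exact (h y hy).mul c.isWordHom_transHom (h z hz)
  · rw [c.pairValue_loopPair hW]
    obtain ⟨h1, h2⟩ := c.sameValues_mulPair_self_iff.1 hyy
    exact (h y hy).loop c.isWordHom_transHom c.transHom_letters h1 h2

/-- The words after some rounds of extension. -/
def wordStage (n : ℕ) : List (List ℕ) := c.nextWords^[n] [[]]

/-- The pairs after some rounds of saturation. -/
noncomputable def pairStage (n m : ℕ) : List (List ℕ × List (List ℕ)) :=
  (c.nextPairs (c.wordStage n))^[m] []

theorem nil_mem_wordStage (n : ℕ) : [] ∈ c.wordStage n := by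
  induction n with
  | zero => exact List.mem_singleton_self _
  | succ n ih =>
    rw [wordStage, Function.iterate_succ_apply']
    exact List.mem_append_left _ ih

/-- Applied to the sets of values, since the lists of words and pairs themselves may grow forever.
-/
theorem exists_stationary {T : Type} [Finite T] (X : ℕ → Set T) (hX : ∀ n, X n ⊆ X (n + 1)) :
    ∃ n, X (n + 1) ⊆ X n := by
  obtain ⟨n, hn⟩ := WellFoundedGT.monotone_chain_condition ⟨X, monotone_nat_of_le_succ hX⟩
  exact ⟨n, (hn (n + 1) (by omega)).symm.subset⟩

theorem exists_completeWords : ∃ n, c.CompleteWords (c.wordStage n) := by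
  obtain ⟨n, hn⟩ := exists_stationary (fun n => c.value '' {w | w ∈ c.wordStage n}) fun n => by
    refine Set.image_mono fun w hw => ?_
    rw [Set.mem_ofPred_eq, wordStage, Function.iterate_succ_apply']
    exact List.mem_append_left _ hw
  refine ⟨n, fun w hw => ?_⟩
  obtain ⟨w', hw', e⟩ := hn ⟨w, by
    rwa [Set.mem_ofPred_eq, wordStage, Function.iterate_succ_apply'], rfl⟩
  exact ⟨w', hw', c.signature_eq_iff.2 e.symm⟩

theorem exists_completePairs (n : ℕ) :
    ∃ m, c.CompletePairs (c.wordStage n) (c.pairStage n m) := by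
  obtain ⟨m, hm⟩ := exists_stationary (fun m => c.pairValue '' {x | x ∈ c.pairStage n m})
    fun m => by
      refine Set.image_mono fun x hx => ?_
      rw [Set.mem_ofPred_eq, pairStage, Function.iterate_succ_apply']
      exact List.mem_append_left _ hx
  refine ⟨m, fun x hx => ?_⟩
  obtain ⟨y, hy, e⟩ := hm ⟨x, by
    rwa [Set.mem_ofPred_eq, pairStage, Function.iterate_succ_apply'], rfl⟩
  exact ⟨y, hy, c.sameValues_iff.2 e.symm⟩

/-- Both stages are complete. -/
def IsComplete (n m : ℕ) : Prop :=
  c.CompleteWords (c.wordStage n) ∧ c.CompletePairs (c.wordStage n) (c.pairStage n m)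

theorem exists_isComplete : ∃ n m, c.IsComplete n m := by
  obtain ⟨n, hn⟩ := c.exists_completeWords
  obtain ⟨m, hm⟩ := c.exists_completePairs n
  exact ⟨n, m, hn, hm⟩

variable {c} in
theorem IsComplete.covers {n m : ℕ} (h : c.IsComplete n m) : c.Covers (c.wordStage n) :=
  CompleteWords.covers c (c.nil_mem_wordStage n) h.1

-- All pairs produced by the procedure are sound, and a complete stage is saturated, hence contains
-- every `Σ₂`-pair.
variable {c} in
theorem IsComplete.isPair_iff {n m : ℕ} (h : c.IsComplete n m) {t s : c.TransMonoid} :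
    IsPair c.transHom t s ↔ ∃ x ∈ c.pairStage n m, c.value x.1 = t ∧ ∃ z ∈ x.2, c.value z = s := by
  have hW := h.covers
  have sound : ∀ k, ∀ x ∈ c.pairStage n k, IsSound c.transHom (c.pairValue x) := by
    intro k
    induction k with
    | zero => exact fun x hx => absurd hx List.not_mem_nil
    | succ k ih =>
      rw [pairStage, Function.iterate_succ_apply']
      exact c.isSound_nextPairs hW ih
  constructor
  · intro hp
    obtain ⟨_, ⟨x, hx, rfl⟩, e, hs⟩ :=
      (CompletePairs.isSaturated c hW h.2).exists_of_isPair c.isWordHom_transHom hp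
    exact ⟨x, hx, e, hs⟩
  · rintro ⟨x, hx, rfl, z, hz, rfl⟩
    exact (sound m x hx).isPair ⟨z, hz, rfl⟩

/-- The test for definability in `Σ₃(<)`. -/
def SigmaTest (W : List (List ℕ)) (D : List (List ℕ × List (List ℕ))) : Prop :=
  ∀ x ∈ D, ∀ z ∈ x.2, c.signature (z ++ z) = c.signature z → ∀ p ∈ W, ∀ q ∈ W,
    c.Accepts (p ++ z ++ q) → c.Accepts (p ++ z ++ x.1 ++ z ++ q)

/-- The test for definability in `Π₃(<)`. -/
def PiTest (W : List (List ℕ)) (D : List (List ℕ × List (List ℕ))) : Prop :=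
  ∀ x ∈ D, ∀ z ∈ x.2, c.signature (z ++ z) = c.signature z → ∀ p ∈ W, ∀ q ∈ W,
    c.Accepts (p ++ z ++ x.1 ++ z ++ q) → c.Accepts (p ++ z ++ q)

-- The stages represent all contexts and all `Σ₂`-pairs, which turns the algebraic condition into a
-- finite check.
variable {c} in
theorem IsComplete.forall_isPair_iff {n m : ℕ} (h : c.IsComplete n m) (P : Set c.TransMonoid) :
    (∀ t e, e * e = e → IsPair c.transHom t e → ∀ p q, p * e * q ∈ P → p * e * t * e * q ∈ P) ↔
      ∀ x ∈ c.pairStage n m, ∀ z ∈ x.2, c.signature (z ++ z) = c.signature z →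
        ∀ p ∈ c.wordStage n, ∀ q ∈ c.wordStage n,
          c.value (p ++ z ++ q) ∈ P → c.value (p ++ z ++ x.1 ++ z ++ q) ∈ P := by
  simp only [h.isPair_iff, signature_eq_iff, value_append]
  constructor
  · intro H x hx z hz hzz p _ q _
    exact H _ _ hzz ⟨x, hx, rfl, z, hz, rfl⟩ _ _
  · rintro H _ _ hee ⟨x, hx, rfl, z, hz, rfl⟩ p q
    obtain ⟨p, hp, rfl⟩ := h.covers p
    obtain ⟨q, hq, rfl⟩ := h.covers q
    exact H x hx z hz hee p hp q hq

variable {c} in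
theorem IsComplete.sigmaDefinable_iff {n m : ℕ} (h : c.IsComplete n m) :
    SigmaDefinable 3 c.language ↔ c.SigmaTest (c.wordStage n) (c.pairStage n m) := by
  have := (sigma_three_iff c.isWordHom_transHom c.transHom_surjective c.acceptSet).trans
    (h.forall_isPair_iff _)
  simp only [transHom_mem_acceptSet, value_mem_acceptSet] at this
  exact (WordLogic.sigmaDefinable_iff 3 c.language).trans this

-- Closure downwards of a language is closure upwards of its complement; the condition for the
-- complement is the contrapositive that `PiTest` expresses.
variable {c} in
theorem IsComplete.piDefinable_iff {n m : ℕ} (h : c.IsComplete n m) :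
    PiDefinable 3 c.language ↔ c.PiTest (c.wordStage n) (c.pairStage n m) := by
  have := (sigma_three_iff c.isWordHom_transHom c.transHom_surjective c.acceptSetᶜ).trans
    (h.forall_isPair_iff _)
  simp only [Set.mem_compl_iff, transHom_mem_acceptSet, value_mem_acceptSet, not_imp_not] at this
  rw [WordLogic.piDefinable_iff]
  refine Iff.trans ?_ this
  refine exists_congr fun r => ⟨fun H w hw u hu hu' => hw (H u hu' w hu), fun H w hw u hu => ?_⟩
  by_contra hu'
  exact H u hu' w hu hw

end AutomatonCode

end Saturation

end WordLogic

namespace WordLogic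

/-! ### Computability of the saturation -/

section Computability

variable {α β γ : Type} [Primcodable α] [Primcodable β] [Primcodable γ]

/-- The decidability instance is arbitrary, so filters by classical decidability are included. -/
theorem primrec_filter {L : α → List β} {p : α → β → Prop} [∀ a, DecidablePred (p a)]
    (hL : Primrec L) (hp : PrimrecPred fun x : α × β => p x.1 x.2) :
    Primrec fun a => (L a).filter fun b => p a b := by
  have h : PrimrecRel fun (b : β) (a : α) => p a b := hp.comp (Primrec.snd.pair Primrec.fst)
  have : DecidableRel fun (b : β) (a : α) => p a b := fun b a => inferInstanceAs (Decidable (p a b))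
  exact (h.listFilter.comp hL .id).of_eq fun a => List.filter_congr fun b _ => by congr

theorem primrecPred_forall_mem {L : α → List β} {p : α → β → Prop}
    (hL : Primrec L) (hp : PrimrecPred fun x : α × β => p x.1 x.2) :
    PrimrecPred fun a => ∀ b ∈ L a, p a b := by
  have : PrimrecRel fun (b : β) (a : α) => p a b := hp.comp (Primrec.snd.pair Primrec.fst)
  exact this.forall_mem_list.comp hL .id

theorem primrecPred_exists_mem {L : α → List β} {p : α → β → Prop}
    (hL : Primrec L) (hp : PrimrecPred fun x : α × β => p x.1 x.2) :
    PrimrecPred fun a => ∃ b ∈ L a, p a b := by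
  have : PrimrecRel fun (b : β) (a : α) => p a b := hp.comp (Primrec.snd.pair Primrec.fst)
  exact this.exists_mem_list.comp hL .id

theorem primrecPred_eq [DecidableEq β] {f g : α → β} (hf : Primrec f) (hg : Primrec g) :
    PrimrecPred fun a => f a = g a := Primrec.eq.comp hf hg

theorem primrecPred_mem [DecidableEq β] {f : α → β} {L : α → List β} (hf : Primrec f)
    (hL : Primrec L) : PrimrecPred fun a => f a ∈ L a :=
  (primrecPred_exists_mem (p := fun a b => b = f a) hL
    (primrecPred_eq .snd (hf.comp .fst))).of_eq fun a => by simp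

theorem primrecPred_imp {p q : α → Prop} (hp : PrimrecPred p) (hq : PrimrecPred q) :
    PrimrecPred fun a => p a → q a :=
  (hp.not.or hq).of_eq fun a => by tauto

theorem primrec_append {f g : α → List β} (hf : Primrec f) (hg : Primrec g) :
    Primrec fun a => f a ++ g a := Primrec.list_append.comp hf hg

theorem primrec_cons {f : α → β} {g : α → List β} (hf : Primrec f) (hg : Primrec g) :
    Primrec fun a => f a :: g a := Primrec.list_cons.comp hf hg

theorem primrec_map {f : α → List β} {g : α → β → γ} (hf : Primrec f)
    (hg : Primrec fun x : α × β => g x.1 x.2) : Primrec fun a => (f a).map (g a) :=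
  Primrec.list_map hf hg

theorem primrec_flatMap {f : α → List β} {g : α → β → List γ} (hf : Primrec f)
    (hg : Primrec fun x : α × β => g x.1 x.2) : Primrec fun a => (f a).flatMap (g a) :=
  Primrec.list_flatMap hf hg

theorem primrec_iterate {f : α → ℕ} {g : α → β} {h : α → β → β} (hf : Primrec f)
    (hg : Primrec g) (hh : Primrec fun x : α × β => h x.1 x.2) :
    Primrec fun a => (h a)^[f a] (g a) := Primrec.nat_iterate hf hg hh

/-- A predicate is computable if it can be tested with the help of a certificate that always
exists. -/
theorem computablePred_of_certificate {P : α → Prop} {G T : α → ℕ → Prop}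
    (hG : PrimrecPred fun x : α × ℕ => G x.1 x.2) (hT : PrimrecPred fun x : α × ℕ => T x.1 x.2)
    (hex : ∀ a, ∃ n, G a n) (h : ∀ a n, G a n → (P a ↔ T a n)) : ComputablePred P := by
  classical
  -- The search for the first certificate is unbounded and ends by `hex`; no estimate of its size is
  -- needed.
  have hfind := Computable.find (P := G) ⟨inferInstance, hG.decide.to_comp⟩ hex
  have : ComputablePred fun a => T a (Nat.find (hex a)) :=
    ⟨inferInstance, hT.decide.to_comp.comp (Computable.id.pair hfind)⟩
  exact this.of_eq fun a => (h a _ (Nat.find_spec (hex a))).symm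

/-! ### Primitive recursiveness of the saturation and of the tests. -/

namespace AutomatonCode

variable {c : α → AutomatonCode}

theorem primrec_range_letters (hc : Primrec c) : Primrec fun a => List.range (c a).1 :=
  Primrec.list_range.comp (Primrec.fst.comp hc)

theorem primrec_range_states (hc : Primrec c) : Primrec fun a => List.range (c a).2.1 :=
  Primrec.list_range.comp (Primrec.fst.comp (Primrec.snd.comp hc))

theorem primrec_stepList {Q : α → List ℕ} {l : α → ℕ} (hc : Primrec c) (hQ : Primrec Q)
    (hl : Primrec l) : Primrec fun a => (c a).stepList (Q a) (l a) := by
  refine Primrec.ite (Primrec.nat_lt.comp hl (Primrec.fst.comp hc)) ?_ hQ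
  refine primrec_filter (p := fun a q' => ∃ q ∈ List.range (c a).2.1, q ∈ Q a ∧
    (q, l a, q') ∈ (c a).2.2.1) (primrec_range_states hc) ?_
  refine primrecPred_exists_mem (p := fun (x : α × ℕ) q => q ∈ Q x.1 ∧
    (q, l x.1, x.2) ∈ (c x.1).2.2.1) (primrec_range_states (hc.comp .fst)) ?_
  have h1 : Primrec fun x : (α × ℕ) × ℕ => x.1.1 := Primrec.fst.comp .fst
  refine (primrecPred_mem .snd (hQ.comp h1)).and (primrecPred_mem
    (Primrec.snd.pair ((hl.comp h1).pair (Primrec.snd.comp .fst))) ?_)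
  exact Primrec.fst.comp (Primrec.snd.comp (Primrec.snd.comp (hc.comp h1)))

theorem primrec_reach {Q w : α → List ℕ} (hc : Primrec c) (hQ : Primrec Q) (hw : Primrec w) :
    Primrec fun a => (c a).reach (Q a) (w a) :=
  Primrec.list_foldl (h := fun a (x : List ℕ × ℕ) => (c a).stepList x.1 x.2) hw hQ
    (primrec_stepList (hc.comp .fst) (Primrec.fst.comp .snd) (Primrec.snd.comp .snd))

theorem primrec_letterSet {w : α → List ℕ} (hc : Primrec c) (hw : Primrec w) :
    Primrec fun a => (c a).letterSet (w a) :=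
  primrec_filter (p := fun a b => b ∈ w a) (primrec_range_letters hc)
    (primrecPred_mem .snd (hw.comp .fst))

theorem primrec_signature {w : α → List ℕ} (hc : Primrec c) (hw : Primrec w) :
    Primrec fun a => (c a).signature (w a) := by
  refine Primrec.pair (primrec_map (g := fun a p => (List.range (c a).2.1).filter fun q =>
    q ∈ (c a).reach [p] (w a)) (primrec_range_states hc) ?_) (primrec_letterSet hc hw)
  refine primrec_filter (p := fun (x : α × ℕ) q => q ∈ (c x.1).reach [x.2] (w x.1))
    (primrec_range_states (hc.comp .fst)) (primrecPred_mem .snd ?_)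
  have h1 : Primrec fun x : (α × ℕ) × ℕ => x.1.1 := Primrec.fst.comp .fst
  exact primrec_reach (hc.comp h1) (primrec_cons (Primrec.snd.comp .fst) (Primrec.const []))
    (hw.comp h1)

theorem primrecPred_accepts {w : α → List ℕ} (hc : Primrec c) (hw : Primrec w) :
    PrimrecPred fun a => (c a).Accepts (w a) := by
  refine primrecPred_exists_mem (p := fun a q => q ∈ (c a).reach (c a).2.2.2.1 (w a) ∧
    q ∈ (c a).2.2.2.2) (primrec_range_states hc) ?_
  have h1 : Primrec fun x : α × ℕ => (c x.1).2.2.2 :=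
    Primrec.snd.comp (Primrec.snd.comp (Primrec.snd.comp (hc.comp .fst)))
  exact (primrecPred_mem .snd (primrec_reach (hc.comp .fst) (Primrec.fst.comp h1)
    (hw.comp .fst))).and (primrecPred_mem .snd (Primrec.snd.comp h1))

theorem primrec_nextWords {W : α → List (List ℕ)} (hc : Primrec c) (hW : Primrec W) :
    Primrec fun a => (c a).nextWords (W a) :=
  primrec_append hW (primrec_flatMap (g := fun a w => (List.range (c a).1).map fun b => w ++ [b])
    hW (primrec_map (g := fun (x : α × List ℕ) b => x.2 ++ [b])
      (primrec_range_letters (hc.comp .fst))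
      (primrec_append (Primrec.snd.comp .fst) (primrec_cons .snd (Primrec.const [])))))

theorem primrecPred_completeWords {W : α → List (List ℕ)} (hc : Primrec c) (hW : Primrec W) :
    PrimrecPred fun a => (c a).CompleteWords (W a) :=
  primrecPred_forall_mem (p := fun a w => ∃ w' ∈ W a, (c a).signature w = (c a).signature w')
    (primrec_nextWords hc hW)
    (primrecPred_exists_mem (p := fun (x : α × List ℕ) w' => (c x.1).signature x.2 =
        (c x.1).signature w') (hW.comp .fst)
      (primrecPred_eq
        (primrec_signature (hc.comp (Primrec.fst.comp .fst)) (Primrec.snd.comp .fst))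
        (primrec_signature (hc.comp (Primrec.fst.comp .fst)) .snd)))

theorem primrec_products {X Y : α → List (List ℕ)} (hX : Primrec X) (hY : Primrec Y) :
    Primrec fun a => products (X a) (Y a) :=
  primrec_flatMap (g := fun a t => (Y a).map fun t' => t ++ t') hX
    (primrec_map (g := fun (x : α × List ℕ) t' => x.2 ++ t') (hY.comp .fst)
      (primrec_append (Primrec.snd.comp .fst) .snd))

theorem primrecPred_valuesSubset {X Y : α → List (List ℕ)} (hc : Primrec c) (hX : Primrec X)
    (hY : Primrec Y) : PrimrecPred fun a => (c a).ValuesSubset (X a) (Y a) :=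
  primrecPred_forall_mem (p := fun a w => ∃ w' ∈ Y a, (c a).signature w = (c a).signature w') hX
    (primrecPred_exists_mem (p := fun (x : α × List ℕ) w' => (c x.1).signature x.2 =
        (c x.1).signature w') (hY.comp .fst)
      (primrecPred_eq
        (primrec_signature (hc.comp (Primrec.fst.comp .fst)) (Primrec.snd.comp .fst))
        (primrec_signature (hc.comp (Primrec.fst.comp .fst)) .snd)))

theorem primrecPred_sameValues {x y : α → List ℕ × List (List ℕ)} (hc : Primrec c)
    (hx : Primrec x) (hy : Primrec y) : PrimrecPred fun a => (c a).SameValues (x a) (y a) :=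
  (primrecPred_eq (primrec_signature hc (Primrec.fst.comp hx))
    (primrec_signature hc (Primrec.fst.comp hy))).and
  ((primrecPred_valuesSubset hc (Primrec.snd.comp hx) (Primrec.snd.comp hy)).and
    (primrecPred_valuesSubset hc (Primrec.snd.comp hy) (Primrec.snd.comp hx)))

theorem primrec_mulPair {x y : α → List ℕ × List (List ℕ)} (hx : Primrec x) (hy : Primrec y) :
    Primrec fun a => mulPair (x a) (y a) :=
  (primrec_append (Primrec.fst.comp hx) (Primrec.fst.comp hy)).pair
    (primrec_products (Primrec.snd.comp hx) (Primrec.snd.comp hy))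

theorem primrec_loopPair {W : α → List (List ℕ)} {x : α → List ℕ × List (List ℕ)}
    (hc : Primrec c) (hW : Primrec W) (hx : Primrec x) :
    Primrec fun a => (c a).loopPair (W a) (x a) :=
  (Primrec.fst.comp hx).pair (primrec_products (primrec_products (Primrec.snd.comp hx)
    (primrec_filter (p := fun a w => (c a).letterSet (x a).1 = (c a).letterSet w) hW
      (primrecPred_eq (primrec_letterSet (hc.comp .fst) (Primrec.fst.comp (hx.comp .fst)))
        (primrec_letterSet (hc.comp .fst) .snd)))) (Primrec.snd.comp hx))

theorem primrec_nextPairs {W : α → List (List ℕ)} {D : α → List (List ℕ × List (List ℕ))}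
    (hc : Primrec c) (hW : Primrec W) (hD : Primrec D) :
    Primrec fun a => (c a).nextPairs (W a) (D a) := by
  classical
  refine primrec_append hD (primrec_cons (Primrec.const _) (primrec_append ?_
    (primrec_append ?_ ?_)))
  · have : Primrec fun x : α × ℕ => [x.2] := primrec_cons .snd (Primrec.const [])
    exact primrec_map (g := fun _ b => ([b], [[b]])) (primrec_range_letters hc)
      (this.pair (primrec_cons this (Primrec.const [])))
  · exact primrec_flatMap (g := fun a x => (D a).map fun y => mulPair x y) hD
      (primrec_map (g := fun (x : α × (List ℕ × List (List ℕ))) y => mulPair x.2 y)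
        (hD.comp .fst) (primrec_mulPair (Primrec.snd.comp .fst) .snd))
  · exact primrec_map (g := fun a x => (c a).loopPair (W a) x)
      (primrec_filter (p := fun a x => (c a).SameValues (mulPair x x) x) hD
        (primrecPred_sameValues (hc.comp .fst) (primrec_mulPair .snd .snd) .snd))
      (primrec_loopPair (hc.comp .fst) (hW.comp .fst) .snd)

theorem primrecPred_completePairs {W : α → List (List ℕ)}
    {D : α → List (List ℕ × List (List ℕ))} (hc : Primrec c) (hW : Primrec W) (hD : Primrec D) :
    PrimrecPred fun a => (c a).CompletePairs (W a) (D a) :=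
  primrecPred_forall_mem (p := fun a x => ∃ y ∈ D a, (c a).SameValues x y)
    (primrec_nextPairs hc hW hD)
    (primrecPred_exists_mem (p := fun (x : α × (List ℕ × List (List ℕ))) y =>
        (c x.1).SameValues x.2 y) (hD.comp .fst)
      (primrecPred_sameValues (hc.comp (Primrec.fst.comp .fst)) (Primrec.snd.comp .fst) .snd))

theorem primrec_wordStage {n : α → ℕ} (hc : Primrec c) (hn : Primrec n) :
    Primrec fun a => (c a).wordStage (n a) :=
  primrec_iterate (h := fun a W => (c a).nextWords W) hn (Primrec.const _)
    (primrec_nextWords (hc.comp .fst) .snd)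

theorem primrec_pairStage {n m : α → ℕ} (hc : Primrec c) (hn : Primrec n) (hm : Primrec m) :
    Primrec fun a => (c a).pairStage (n a) (m a) :=
  primrec_iterate (h := fun a D => (c a).nextPairs ((c a).wordStage (n a)) D) hm
    (Primrec.const _)
    (primrec_nextPairs (hc.comp .fst) ((primrec_wordStage hc hn).comp .fst) .snd)

theorem primrecPred_isComplete {n m : α → ℕ} (hc : Primrec c) (hn : Primrec n)
    (hm : Primrec m) : PrimrecPred fun a => (c a).IsComplete (n a) (m a) :=
  (primrecPred_completeWords hc (primrec_wordStage hc hn)).and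
    (primrecPred_completePairs hc (primrec_wordStage hc hn) (primrec_pairStage hc hn hm))

/-- The tests quantify over the pairs, the idempotent values below them, and two words. -/
theorem primrecPred_forall_context {W : α → List (List ℕ)}
    {D : α → List (List ℕ × List (List ℕ))} (hc : Primrec c) (hW : Primrec W) (hD : Primrec D)
    {T : AutomatonCode → List ℕ → List ℕ → Prop}
    (hT : PrimrecPred fun x : AutomatonCode × List ℕ × List ℕ => T x.1 x.2.1 x.2.2) :
    PrimrecPred fun a => ∀ x ∈ D a, ∀ z ∈ x.2, (c a).signature (z ++ z) = (c a).signature z →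
      ∀ p ∈ W a, ∀ q ∈ W a, T (c a) (p ++ z ++ q) (p ++ z ++ x.1 ++ z ++ q) := by
  refine primrecPred_forall_mem (p := fun a (x : List ℕ × List (List ℕ)) => ∀ z ∈ x.2,
    (c a).signature (z ++ z) = (c a).signature z → ∀ p ∈ W a, ∀ q ∈ W a,
      T (c a) (p ++ z ++ q) (p ++ z ++ x.1 ++ z ++ q)) hD ?_
  refine primrecPred_forall_mem (p := fun (y : α × (List ℕ × List (List ℕ))) z =>
    (c y.1).signature (z ++ z) = (c y.1).signature z → ∀ p ∈ W y.1, ∀ q ∈ W y.1,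
      T (c y.1) (p ++ z ++ q) (p ++ z ++ y.2.1 ++ z ++ q)) (Primrec.snd.comp .snd) ?_
  have h1 : Primrec fun y : (α × (List ℕ × List (List ℕ))) × List ℕ => y.1.1 :=
    Primrec.fst.comp .fst
  refine primrecPred_imp (primrecPred_eq (primrec_signature (hc.comp h1)
    (primrec_append .snd .snd)) (primrec_signature (hc.comp h1) .snd)) ?_
  refine primrecPred_forall_mem (p := fun (y : (α × (List ℕ × List (List ℕ))) × List ℕ) p =>
    ∀ q ∈ W y.1.1, T (c y.1.1) (p ++ y.2 ++ q) (p ++ y.2 ++ y.1.2.1 ++ y.2 ++ q))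
    (hW.comp h1) ?_
  refine primrecPred_forall_mem
    (p := fun (y : ((α × (List ℕ × List (List ℕ))) × List ℕ) × List ℕ) q =>
      T (c y.1.1.1) (y.2 ++ y.1.2 ++ q) (y.2 ++ y.1.2 ++ y.1.1.2.1 ++ y.1.2 ++ q))
    (hW.comp (h1.comp .fst)) ?_
  let Z := (((α × (List ℕ × List (List ℕ))) × List ℕ) × List ℕ) × List ℕ
  have hy : Primrec fun y : Z => y.1.1.1 := Primrec.fst.comp (Primrec.fst.comp .fst)
  have hp : Primrec fun y : Z => y.1.2 := Primrec.snd.comp .fst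
  have hz : Primrec fun y : Z => y.1.1.2 := Primrec.snd.comp (Primrec.fst.comp .fst)
  have hx : Primrec fun y : Z => y.1.1.1.2.1 := Primrec.fst.comp (Primrec.snd.comp hy)
  have hpz := primrec_append hp hz
  exact hT.comp ((hc.comp (Primrec.fst.comp hy)).pair ((primrec_append hpz .snd).pair
    (primrec_append (primrec_append (primrec_append hpz hx) hz) .snd)))

/-- The certificate is a number coding two numbers of rounds after which words and pairs are
complete; completeness is primitive recursive and is always reached. -/
theorem computablePred_of_test {P : AutomatonCode → Prop}
    {T : AutomatonCode → List (List ℕ) → List (List ℕ × List (List ℕ)) → Prop}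
    (hT : ∀ {n m : AutomatonCode × ℕ → ℕ}, Primrec n → Primrec m → PrimrecPred fun x : AutomatonCode × ℕ =>
      T x.1 (x.1.wordStage (n x)) (x.1.pairStage (n x) (m x)))
    (h : ∀ c n m, c.IsComplete n m → (P c ↔ T c (c.wordStage n) (c.pairStage n m))) :
    ComputablePred P := by
  have h1 : Primrec fun x : AutomatonCode × ℕ => x.2.unpair.1 :=
    Primrec.fst.comp (Primrec.unpair.comp .snd)
  have h2 : Primrec fun x : AutomatonCode × ℕ => x.2.unpair.2 :=
    Primrec.snd.comp (Primrec.unpair.comp .snd)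
  refine computablePred_of_certificate (G := fun c n => c.IsComplete n.unpair.1 n.unpair.2)
    (T := fun c n => T c (c.wordStage n.unpair.1) (c.pairStage n.unpair.1 n.unpair.2))
    (primrecPred_isComplete .fst h1 h2) (hT h1 h2) (fun c => ?_) fun c n => h c _ _
  obtain ⟨n, m, hnm⟩ := c.exists_isComplete
  exact ⟨Nat.pair n m, by simpa using hnm⟩

theorem primrecPred_sigmaTest {W : α → List (List ℕ)} {D : α → List (List ℕ × List (List ℕ))}
    (hc : Primrec c) (hW : Primrec W) (hD : Primrec D) :
    PrimrecPred fun a => (c a).SigmaTest (W a) (D a) :=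
  primrecPred_forall_context (T := fun c u v => c.Accepts u → c.Accepts v) hc hW hD
    (primrecPred_imp (primrecPred_accepts .fst (Primrec.fst.comp .snd))
      (primrecPred_accepts .fst (Primrec.snd.comp .snd)))

theorem primrecPred_piTest {W : α → List (List ℕ)} {D : α → List (List ℕ × List (List ℕ))}
    (hc : Primrec c) (hW : Primrec W) (hD : Primrec D) :
    PrimrecPred fun a => (c a).PiTest (W a) (D a) :=
  primrecPred_forall_context (T := fun c u v => c.Accepts v → c.Accepts u) hc hW hD
    (primrecPred_imp (primrecPred_accepts .fst (Primrec.snd.comp .snd))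
      (primrecPred_accepts .fst (Primrec.fst.comp .snd)))

end AutomatonCode

end Computability

end WordLogic

/-! ### Decidability of the three problems. -/

open WordLogic AutomatonCode in
theorem corollary3 :
    ComputablePred (fun c : WordLogic.AutomatonCode => WordLogic.DeltaDefinable 3 c.language) ∧
    ComputablePred (fun c : WordLogic.AutomatonCode => WordLogic.SigmaDefinable 3 c.language) ∧
    ComputablePred (fun c : WordLogic.AutomatonCode => WordLogic.PiDefinable 3 c.language) := by
  have hs : ∀ {n m : AutomatonCode × ℕ → ℕ}, Primrec n → Primrec m → PrimrecPred fun x : AutomatonCode × ℕ =>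
      x.1.SigmaTest (x.1.wordStage (n x)) (x.1.pairStage (n x) (m x)) := fun hn hm =>
    primrecPred_sigmaTest .fst (primrec_wordStage .fst hn) (primrec_pairStage .fst hn hm)
  have hp : ∀ {n m : AutomatonCode × ℕ → ℕ}, Primrec n → Primrec m → PrimrecPred fun x : AutomatonCode × ℕ =>
      x.1.PiTest (x.1.wordStage (n x)) (x.1.pairStage (n x) (m x)) := fun hn hm =>
    primrecPred_piTest .fst (primrec_wordStage .fst hn) (primrec_pairStage .fst hn hm)
  refine ⟨?_, ?_, ?_⟩
  -- The same complete stage serves both tests.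
  · exact computablePred_of_test (T := fun c W D => c.SigmaTest W D ∧ c.PiTest W D)
      (fun hn hm => (hs hn hm).and (hp hn hm))
      fun c n m h => and_congr h.sigmaDefinable_iff h.piDefinable_iff
  · exact computablePred_of_test (T := fun c W D => c.SigmaTest W D) hs
      fun c n m h => h.sigmaDefinable_iff
  · exact computablePred_of_test (T := fun c W D => c.PiTest W D) hp
      fun c n m h => h.piDefinable_iff
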